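/- **Setting.** Let $X=(X_t)_{t\ge 0}$ be an upwards skip-free Lévy chain with $h=1$: a compound Poisson process (a Lévy process with càdlàg paths and $\mathsf E[e^{iuX_t}]=\exp\{t\int(e^{iux}-1)\lambda(dx)\}$, where the Lévy measure $\lambda$ is finite and nonzero with $\lambda(\{0\})=0$) such that $\mathrm{supp}(\lambda)\subset\mathbb Z$ and $\mathrm{supp}(\lambda|_{(0,\infty)})=\{1\}$. Put $$\gamma:=\lambda(\mathbb R),\qquad p:=\lambda(\{1\})/\gamma,\qquad q_l:=\lambda(\{-l\})/\gamma\ (l\ge 1),$$ and let $P=(P_{kl})_{k,l\in\mathbb Z}$, $P_{kl}=\lambda(\{l-k\})/\gamma$, be the transition matrix of the jump chain of $X$. Let $\psi(\beta)=\int(e^{\beta x}-1)\lambda(dx)$ $(\beta\ge0)$ be the Laplace exponent, $\Phi(0)$ its largest zero on $[0,\infty)$ and $\Phi:[0,\infty)\to[\Phi(0),\infty)$ the inverse of $\psi|_{[\Phi(0),\infty)}$. Let $D_1=\sup\{-X_s: 0\le s<T_1\}$ with $T_1=\inf\{t\ge0:X_t\ge 1\}$ be the depth of the path below $0$ before it reaches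 level $1$. The scale function of $X$ is $$W(x)=C\Big/\prod_{r=1}^{\lfloor x\rfloor}\mathsf P(D_1\le r-1)\quad(x\ge0),$$ where the constant $C$ is determined by $\int_0^\infty e^{-\beta x}W(x)\,dx=\frac{e^{\beta}-1}{\beta\psi(\beta)}$ for $\beta>\Phi(0)$; $W=0$ on $(-\infty,0)$. For $c\ge 0$ let $\mathsf P_c$ be the measure on the canonical space of càdlàg paths with $\mathsf P_c(\Lambda)=\mathsf E[e^{cX_t-\psi(c)t}\mathbf 1_\Lambda]$ for $\Lambda\in\mathcal F_t$, $t\ge0$ (here $X$ is transferred to that space as its coordinate process, with natural filtration $(\mathcal F_t)_{t\ge 0}$), and let $W_c$ be the scale function of $(X,\mathsf P_c)$, whose Lévy measure is $e^{cx}\lambda(dx)$. For $q\ge 0$ set $$W^{(q)}(x)=e^{\Phi(q)\lfloor 1+x\rfloor}W_{\Phi(q)}(x),\qquad Z^{(q)}(x)=1+q\int_0^{\lfloor x\rfloor}W^{(q)}(z)\,dz\qquad(x\ge0),$$ and $W^{(q)}(x)=0$, $Z^{(q)}(x)=1$ for $x<0$. **Proposition (Calculation of $W^{(q)}$ and $Z^{(q)}$).**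 Let $q\ge 0$. For all integers $k\ge 0$ the following series converge (absolutely) and $$\sum_{l\in\mathbb Z}P_{kl}W^{(q)}(l)=\Big(1+\frac q\gamma\Big)W^{(q)}(k),\qquad \sum_{l\in\mathbb Z}P_{kl}Z^{(q)}(l)=\Big(1+\frac q\gamma\Big)Z^{(q)}(k),$$ that is, for all integers $k\ge0$, $$pW^{(q)}(k+1)=\Big(1+\frac q\gamma\Big)W^{(q)}(k)-\sum_{l=1}^{k}q_l\,W^{(q)}(k-l),$$ $$pZ^{(q)}(k+1)+\Big(1-p-\sum_{l=1}^{k-1}q_l\Big)=\Big(1+\frac q\gamma\Big)Z^{(q)}(k)-\sum_{l=1}^{k-1}q_l\,Z^{(q)}(k-l).$$ Moreover $W^{(q)}(k)=0$ for all integers $k<0$, $W^{(q)}(0)=1/\lambda(\{1\})$, and $Z^{(q)}(k)=1$ for all integers $k\le 0$. -/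

import Mathlib

open MeasureTheory ProbabilityTheory Filter Topology
open scoped NNReal ENNReal

noncomputable section

namespace SkipFree

/-- Right-continuous with left limits (at `t = 0` the left-limit condition is empty). -/
def IsCadlag (w : ℝ≥0 → ℝ) : Prop :=
  ∀ t : ℝ≥0, ContinuousWithinAt w (Set.Ici t) t ∧ ∃ l : ℝ, Tendsto w (𝓝[<] t) (𝓝 l)

/-- A real Lévy process, all of whose sample paths are càdlàg. -/
structure IsLevyProcess {Ω : Type*} [MeasurableSpace Ω] (X : ℝ≥0 → Ω → ℝ) (P : Measure Ω) :
    Prop where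
  isProbabilityMeasure : IsProbabilityMeasure P
  measurable : ∀ t, Measurable (X t)
  cadlag : ∀ ω, IsCadlag (fun t => X t ω)
  start : ∀ᵐ ω ∂P, X 0 ω = 0
  indep : HasIndepIncrements X P
  stationary : ∀ s t : ℝ≥0, IdentDistrib (fun ω => X (s + t) ω - X s ω) (X t) P P

/-- A compound Poisson process with Lévy measure `lam`: a Lévy process with
`E[exp(i u X_t)] = exp(t ∫ (exp(i u x) - 1) lam(dx))`, where `lam` is finite, nonzero and does
not charge `0`. -/
structure IsCompoundPoisson {Ω : Type*} [MeasurableSpace Ω] (X : ℝ≥0 → Ω → ℝ) (P : Measure Ω)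
    (lam : Measure ℝ) : Prop extends IsLevyProcess X P where
  finite : IsFiniteMeasure lam
  ne_zero : lam ≠ 0
  no_zero : lam {0} = 0
  charFun_eq : ∀ (t : ℝ≥0) (u : ℝ), charFun (P.map (X t)) u =
    Complex.exp ((t : ℂ) * ∫ x, (Complex.exp (Complex.I * u * x) - 1) ∂lam)

/-- The lattice `ℤ_h = {h k : k ∈ ℤ}`. -/
def lattice (h : ℝ) : Set ℝ := Set.range (fun k : ℤ => h * (k : ℝ))

/-- An upwards skip-free Lévy chain with values in `ℤ_h` and with Lévy measure `lam`. -/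
structure IsSkipFreeLevyChain {Ω : Type*} [MeasurableSpace Ω] (h : ℝ) (X : ℝ≥0 → Ω → ℝ)
    (P : Measure Ω) (lam : Measure ℝ) : Prop extends IsCompoundPoisson X P lam where
  h_pos : 0 < h
  support_subset : lam.support ⊆ lattice h
  support_pos : (lam.restrict (Set.Ioi 0)).support = {h}

/-! ### Laplace exponent -/

/-- The Laplace exponent `ψ(β) = ∫ (exp(β x) - 1) lam(dx)` (used for `β ≥ 0`). -/
def laplaceExponent (lam : Measure ℝ) (β : ℝ) : ℝ := ∫ x, (Real.exp (β * x) - 1) ∂lam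

/-- `Φ(0)`, the largest zero of `ψ` on `[0, ∞)`. -/
def largestZero (lam : Measure ℝ) : ℝ := sSup {β : ℝ | 0 ≤ β ∧ laplaceExponent lam β = 0}

/-- `Φ : [0, ∞) → [Φ(0), ∞)`, the inverse of the bijection `ψ : [Φ(0), ∞) → [0, ∞)`. -/
def invLaplaceExponent (lam : Measure ℝ) : ℝ → ℝ :=
  Function.invFunOn (laplaceExponent lam) (Set.Ici (largestZero lam))

/-! ### Canonical path space and exponential change of measure -/

/-- The space of càdlàg paths; it carries the σ-algebra generated by the evaluation maps (the
trace of the product σ-algebra). -/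
abbrev Path : Type := {w : ℝ≥0 → ℝ // IsCadlag w}

/-- The natural filtration of the coordinate process. -/
abbrev pathFiltration (t : ℝ≥0) : MeasurableSpace Path :=
  ⨆ s : ℝ≥0, ⨆ _ : s ≤ t, MeasurableSpace.comap (fun w : Path => w.1 s) inferInstance

/-- The law of a process with càdlàg paths on the canonical path space. -/
def pathLaw {Ω : Type*} [MeasurableSpace Ω] (X : ℝ≥0 → Ω → ℝ)
    (hX : ∀ ω, IsCadlag (fun t => X t ω)) (P : Measure Ω) : Measure Path :=
  P.map (fun ω => (⟨fun t => X t ω, hX ω⟩ : Path))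

/-- `ν_c` satisfies `ν_c(Λ) = E_ν[exp(c X_t - ψ(c) t) ; Λ]` for all `t ≥ 0` and `Λ ∈ 𝓕_t`,
`X` being the coordinate process. -/
def IsExpChange (lam : Measure ℝ) (ν : Measure Path) (c : ℝ) (νc : Measure Path) : Prop :=
  ∀ (t : ℝ≥0) (Λ : Set Path), MeasurableSet[pathFiltration t] Λ →
    νc Λ = ∫⁻ w in Λ, ENNReal.ofReal (Real.exp (c * w.1 t - laplaceExponent lam c * t)) ∂ν

/-- The measure `P_c` on path space: the (unique) measure determined by `IsExpChange`. -/
def expChange (lam : Measure ℝ) (ν : Measure Path) (c : ℝ) : Measure Path :=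
  Classical.epsilon (IsExpChange lam ν c)

/-- The Lévy measure `exp(c x) lam(dx)` of the coordinate process under `P_c`. -/
def tilt (lam : Measure ℝ) (c : ℝ) : Measure ℝ :=
  lam.withDensity (fun x => ENNReal.ofReal (Real.exp (c * x)))

/-! ### Scale functions -/

/-- First entrance time `T_x = inf {t ≥ 0 : w_t ≥ x}`, with `inf ∅ = ∞`. -/
def firstEntrance (x : ℝ) (w : Path) : ℝ≥0∞ := ⨅ (t : ℝ≥0) (_ : x ≤ w.1 t), (t : ℝ≥0∞)

/-- `D₁`, the depth below the starting maximum `0` of the path before it first reaches the new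
maximum `h` (before time `∞` if `h` is never reached). -/
def depth (h : ℝ) (w : Path) : EReal :=
  ⨆ (s : ℝ≥0) (_ : (s : ℝ≥0∞) < firstEntrance h w), ((-(w.1 s) : ℝ) : EReal)

/-- The unnormalised scale function
`x ↦ 1 / ∏_{r = 1}^{⌊x / h⌋} ν(D₁ ≤ (r - 1) h)`, for `x ≥ 0`. -/
def rawScale (h : ℝ) (ν : Measure Path) (x : ℝ) : ℝ :=
  1 / ∏ r ∈ Finset.Icc 1 ⌊x / h⌋₊, ν.real {w | depth h w ≤ ((((r : ℝ) - 1) * h : ℝ) : EReal)}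

/-- `C` is the constant for which `C * rawScale` has Laplace transform
`(exp(β h) - 1) / (β h ψ(β))` at all `β > Φ(0)`. (The right-hand side is nonzero there, so that
the equation includes the convergence of the integral.) -/
def IsNormalisation (h : ℝ) (ν : Measure Path) (lam : Measure ℝ) (C : ℝ) : Prop :=
  ∀ β : ℝ, largestZero lam < β →
    ∫ x in Set.Ioi (0 : ℝ), Real.exp (-β * x) * (C * rawScale h ν x) =
      (Real.exp (β * h) - 1) / (β * h * laplaceExponent lam β)

/-- The scale function `W` of the coordinate process under `ν`, with Lévy measure `lam`,
normalised through its Laplace transform and extended by `0` to the negative half-line. -/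
def scaleW (h : ℝ) (ν : Measure Path) (lam : Measure ℝ) (x : ℝ) : ℝ :=
  if x < 0 then 0 else Classical.epsilon (IsNormalisation h ν lam) * rawScale h ν x

/-- `W^{(q)}(x) = exp(Φ(q) ⌊1 + x / h⌋ h) W_{Φ(q)}(x)` for `x ≥ 0` and `0` for `x < 0`, where
`W_c` is the scale function `W` of the process under `P_c`. -/
def qScaleW (h : ℝ) (ν : Measure Path) (lam : Measure ℝ) (q : ℝ) (x : ℝ) : ℝ :=
  if x < 0 then 0 else
    Real.exp (invLaplaceExponent lam q * (⌊1 + x / h⌋ : ℝ) * h) *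
      scaleW h (expChange lam ν (invLaplaceExponent lam q))
        (tilt lam (invLaplaceExponent lam q)) x

/-- `Z^{(q)}(x) = 1 + q ∫_0^{⌊x / h⌋ h} W^{(q)}(z) dz` for `x ≥ 0` and `1` for `x < 0`. -/
def qScaleZ (h : ℝ) (ν : Measure Path) (lam : Measure ℝ) (q : ℝ) (x : ℝ) : ℝ :=
  if x < 0 then 1 else 1 + q * ∫ z in (0 : ℝ)..((⌊x / h⌋ : ℝ) * h), qScaleW h ν lam q z

/-- The transition matrix, on `ℤ`, of the jump chain of a compound Poisson process with Lévy
measure `lam` carried by `ℤ`: the random walk whose steps have law `lam / lam(ℝ)`. -/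
def jumpMatrix (lam : Measure ℝ) (k l : ℤ) : ℝ :=
  lam.real {((l - k : ℤ) : ℝ)} / lam.real Set.univ

end SkipFree

end

/-! Write `λ` for the Lévy measure, `γ` for its mass, and let `w` be the sequence `scaleSeq`: `w 0 =
1` and `λ{1} w(k+1) + ∑ λ{-l} w(k-l) = γ w(k)`. Extended by `0` below, `w` is harmonic for the jump
chain killed on leaving the non-negative integers. Optional stopping of `w(n + X)` at the exit from
`[-n, 1)` therefore gives `P(D₁ ≤ n) = w(n) / w(n+1)` (`IsIncrementLaw.real_depth_le`), and the
product defining the scale function telescopes to `w(⌊x⌋)`. Since `∑ w(n) e^{-βn} = λ{1} e^β / ψ(β)`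
for `β > Φ(0)` (`hasSum_scaleSeq`), the normalising constant is `1 / λ{1}`.

All of this is applied to `P_c` with `c = Φ(q)`. There the atoms are `e^{cx} λ{x}` and the total
mass is `γ + ψ(c) = γ + q`. The factor `e^{c(k+1)}` in `W^{(q)}` cancels the weights on the atoms,
which leaves the original recursion with `γ` replaced by `γ + q` (`qScaleSeq_succ`). Summing over
`k` gives the statement for `Z^{(q)} - 1`, and the row sums of the jump matrix restore the constant.

Two analytic points carry the length. First, `P_c` and the normalising constant are picked by
choice, so existence must be proved: `P_c` is realised by concatenating independent copies of the
tilted path over unit time intervals (`exists_expChange`), and the constant is shown to be unique as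
well. Second, optional stopping is done along dyadic grids. All it needs is that one-step laws
dominate the part of the compound Poisson law with at most one jump (`IsStepFamily`), a property
stable under tilting. A step of length `δ` then costs `O(δ²)`, which is negligible over `N 2^N`
steps of length `2^{-N}`. -/

noncomputable section

namespace SkipFree

/-! ### Skip-free jump measures and compound Poisson laws -/

/-- A finite measure on `ℤ`, not charging `0`, with `1` its only positive atom. -/
structure IsSkipFreeMeasure (lam : Measure ℝ) : Prop where
  finite : IsFiniteMeasure lam
  int : lam (Set.range ((↑) : ℤ → ℝ))ᶜ = 0
  upper : lam (Set.Ioi 1) = 0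
  zero : lam {0} = 0
  one : lam {1} ≠ 0

lemma measurableSet_range_intCast : MeasurableSet (Set.range ((↑) : ℤ → ℝ)) :=
  (Set.countable_range _).measurableSet

/-- The complement of the topological support is null, so the support conditions become null-set
conditions. The point `1` must be an atom, since otherwise the restriction to `(0, ∞)` would vanish
and have empty support. -/
lemma IsSkipFreeLevyChain.isSkipFreeMeasure {Ω : Type*} [MeasurableSpace Ω] {P : Measure Ω}
    {X : ℝ≥0 → Ω → ℝ} {lam : Measure ℝ} (hX : IsSkipFreeLevyChain 1 X P lam) :
    IsSkipFreeMeasure lam := by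
  have h1 : (lam.restrict (Set.Ioi 0)) {1}ᶜ = 0 := by
    rw [← hX.support_pos]; exact Measure.measure_compl_support
  have h2 : lam ({1}ᶜ ∩ Set.Ioi 0) = 0 := by
    rwa [Measure.restrict_apply (measurableSet_singleton _).compl] at h1
  refine ⟨hX.finite, ?_, ?_, hX.no_zero, ?_⟩
  · refine measure_mono_null (Set.compl_subset_compl.2 ?_) (Measure.measure_compl_support (μ := lam))
    refine hX.support_subset.trans ?_
    rintro _ ⟨k, rfl⟩
    exact ⟨k, by simp⟩
  · refine measure_mono_null (fun x hx => ?_) h2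
    have : (1 : ℝ) < x := hx
    exact ⟨by simpa using this.ne', by simp; linarith⟩
  · intro h
    have h3 : lam.restrict (Set.Ioi 0) = 0 := by
      rw [← Measure.measure_univ_eq_zero, Measure.restrict_apply_univ]
      refine measure_mono_null (fun x hx => ?_) (measure_union_null h h2)
      by_cases hx1 : x = 1
      · exact Or.inl hx1
      · exact Or.inr ⟨hx1, hx⟩
    have := hX.support_pos
    rw [h3, Measure.support_zero] at this
    exact (Set.singleton_nonempty (1 : ℝ)).ne_empty this.symm

namespace IsSkipFreeMeasure

variable {lam : Measure ℝ} (h : IsSkipFreeMeasure lam)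
include h

lemma ae_int : ∀ᵐ x ∂lam, ∃ k : ℤ, (k : ℝ) = x := by
  rw [ae_iff]; exact h.int

lemma ae_le_one : ∀ᵐ x ∂lam, x ≤ 1 := by
  rw [ae_iff]; convert h.upper using 2; ext x; simp

lemma integrable_exp {c : ℝ} (hc : 0 ≤ c) : Integrable (fun x => Real.exp (c * x)) lam := by
  have := h.finite
  refine (integrable_const (Real.exp c)).mono (by fun_prop) ?_
  filter_upwards [h.ae_le_one] with x hx
  rw [Real.norm_of_nonneg (Real.exp_pos _).le, Real.norm_of_nonneg (Real.exp_pos _).le]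
  exact Real.exp_le_exp.2 (by nlinarith)

lemma integral_exp {c : ℝ} (hc : 0 ≤ c) :
    ∫ x, Real.exp (c * x) ∂lam = laplaceExponent lam c + lam.real Set.univ := by
  have := h.finite
  rw [laplaceExponent, integral_sub (h.integrable_exp hc) (integrable_const _)]
  simp

lemma lintegral_exp {c : ℝ} (hc : 0 ≤ c) :
    ∫⁻ x, ENNReal.ofReal (Real.exp (c * x)) ∂lam =
      ENNReal.ofReal (laplaceExponent lam c + lam.real Set.univ) := by
  rw [← h.integral_exp hc, ofReal_integral_eq_lintegral_ofReal (h.integrable_exp hc)]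
  exact Eventually.of_forall fun x => (Real.exp_pos _).le

lemma laplaceExponent_add_nonneg {c : ℝ} (hc : 0 ≤ c) :
    0 ≤ laplaceExponent lam c + lam.real Set.univ := by
  rw [← h.integral_exp hc]; exact integral_nonneg fun x => (Real.exp_pos _).le

/-- At `c = Φ(q)` this mass is `γ + q`, the source of the eigenvalue `1 + q / γ`. -/
lemma tilt_univ {c : ℝ} (hc : 0 ≤ c) :
    (tilt lam c).real Set.univ = laplaceExponent lam c + lam.real Set.univ := by
  rw [measureReal_def, tilt, withDensity_apply _ MeasurableSet.univ, Measure.restrict_univ,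
    h.lintegral_exp hc, ENNReal.toReal_ofReal (h.laplaceExponent_add_nonneg hc)]

omit h in
lemma _root_.SkipFree.tilt_singleton (lam : Measure ℝ) (c x : ℝ) :
    tilt lam c {x} = ENNReal.ofReal (Real.exp (c * x)) * lam {x} := by
  rw [tilt, withDensity_apply _ (measurableSet_singleton _), lintegral_singleton]

omit h in
lemma _root_.SkipFree.tilt_real_singleton (lam : Measure ℝ) (c x : ℝ) :
    (tilt lam c).real {x} = Real.exp (c * x) * lam.real {x} := by
  rw [measureReal_def, tilt_singleton, ENNReal.toReal_mul,
    ENNReal.toReal_ofReal (Real.exp_pos _).le, measureReal_def]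

/-- Stability under tilting lets every result on the scale sequence apply to `P_c`. -/
protected lemma tilt {c : ℝ} (hc : 0 ≤ c) : IsSkipFreeMeasure (tilt lam c) := by
  have hac : tilt lam c ≪ lam := withDensity_absolutelyContinuous _ _
  refine ⟨⟨?_⟩, hac h.int, hac h.upper, hac h.zero, ?_⟩
  · rw [tilt, withDensity_apply _ MeasurableSet.univ, Measure.restrict_univ, h.lintegral_exp hc]
    exact ENNReal.ofReal_lt_top
  · rw [tilt_singleton]
    exact mul_ne_zero (by simp [Real.exp_pos]) h.one

end IsSkipFreeMeasure

/-- Convolution powers. -/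
def convPow (lam : Measure ℝ) : ℕ → Measure ℝ
  | 0 => Measure.dirac 0
  | k + 1 => lam ∗ convPow lam k

instance isFiniteMeasure_convPow (lam : Measure ℝ) [IsFiniteMeasure lam] (k : ℕ) :
    IsFiniteMeasure (convPow lam k) := by
  induction k with
  | zero => rw [convPow]; infer_instance
  | succ k ih => rw [convPow]; infer_instance

lemma charFun_convPow (lam : Measure ℝ) [IsFiniteMeasure lam] (k : ℕ) (u : ℝ) :
    charFun (convPow lam k) u = charFun lam u ^ k := by
  induction k with
  | zero => simp [convPow]
  | succ k ih => rw [convPow, charFun_conv, ih, pow_succ']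

lemma lintegral_exp_convPow (lam : Measure ℝ) [IsFiniteMeasure lam] (k : ℕ) (c : ℝ) :
    ∫⁻ x, ENNReal.ofReal (Real.exp (c * x)) ∂(convPow lam k) =
      (∫⁻ x, ENNReal.ofReal (Real.exp (c * x)) ∂lam) ^ k := by
  induction k with
  | zero => simp [convPow]
  | succ k ih =>
    rw [convPow, Measure.lintegral_conv (by fun_prop), pow_succ']
    simp_rw [mul_add, Real.exp_add, ENNReal.ofReal_mul (Real.exp_pos _).le]
    simp_rw [lintegral_const_mul' _ _ ENNReal.ofReal_ne_top, ih]
    rw [lintegral_mul_const _ (by fun_prop)]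

lemma convPow_int {lam : Measure ℝ} [IsFiniteMeasure lam]
    (h : lam (Set.range ((↑) : ℤ → ℝ))ᶜ = 0) (k : ℕ) :
    convPow lam k (Set.range ((↑) : ℤ → ℝ))ᶜ = 0 := by
  have hm := measurableSet_range_intCast.compl
  induction k with
  | zero =>
    rw [convPow, Measure.dirac_apply' _ hm]
    simp
  | succ k ih =>
    rw [convPow, ← lintegral_indicator_one hm, Measure.lintegral_conv (by measurability)]
    rw [← nonpos_iff_eq_zero, ← lintegral_zero (μ := lam)]
    refine lintegral_mono_ae ?_
    have h1 : ∀ᵐ x ∂lam, x ∈ Set.range ((↑) : ℤ → ℝ) := by rw [ae_iff]; exact h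
    have h2 : ∀ᵐ x ∂(convPow lam k), x ∈ Set.range ((↑) : ℤ → ℝ) := by rw [ae_iff]; exact ih
    filter_upwards [h1] with x hx
    rw [← lintegral_zero (μ := convPow lam k)]
    refine lintegral_mono_ae ?_
    filter_upwards [h2] with y hy
    obtain ⟨a, rfl⟩ := hx
    obtain ⟨b, rfl⟩ := hy
    rw [Set.indicator_of_notMem]
    simp only [Set.mem_compl_iff, not_not]
    exact ⟨a + b, by push_cast; rfl⟩

/-- The law at time `t` of a compound Poisson process with Lévy measure `lam`. -/
def compoundPoissonLaw (lam : Measure ℝ) (t : ℝ≥0) : Measure ℝ :=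
  Measure.sum fun k : ℕ =>
    ENNReal.ofReal (Real.exp (-(lam.real Set.univ * t)) * (t ^ k / k.factorial)) • convPow lam k

lemma hasSum_exp_mul (a M t : ℝ) :
    HasSum (fun k : ℕ => a * (t ^ k / k.factorial) * M ^ k) (a * Real.exp (t * M)) := by
  have := (NormedSpace.expSeries_div_hasSum_exp (t * M)).mul_left a
  rw [← Real.exp_eq_exp_ℝ] at this
  have h2 : (fun k : ℕ => a * (t ^ k / k.factorial) * M ^ k) =
      fun k : ℕ => a * ((t * M) ^ k / k.factorial) := by
    ext k; rw [mul_pow]; ring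
  rwa [h2]

/-- Exponential moments are multiplicative over convolution powers, so the Poisson weights sum to an
exponential series. The case `c = 0` is the total mass. -/
lemma lintegral_exp_compoundPoissonLaw (lam : Measure ℝ) [IsFiniteMeasure lam] {c M : ℝ}
    (hM : 0 ≤ M) (h : ∫⁻ x, ENNReal.ofReal (Real.exp (c * x)) ∂lam = ENNReal.ofReal M) (t : ℝ≥0) :
    ∫⁻ x, ENNReal.ofReal (Real.exp (c * x)) ∂(compoundPoissonLaw lam t) =
      ENNReal.ofReal (Real.exp ((M - lam.real Set.univ) * t)) := by
  have hs := hasSum_exp_mul (Real.exp (-(lam.real Set.univ * t))) M t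
  rw [compoundPoissonLaw, lintegral_sum_measure]
  simp_rw [lintegral_smul_measure, lintegral_exp_convPow, h, smul_eq_mul]
  rw [show (M - lam.real Set.univ) * (t : ℝ) = -(lam.real Set.univ * t) + t * M by ring,
    Real.exp_add, ← hs.tsum_eq, ENNReal.ofReal_tsum_of_nonneg (fun k => by positivity) hs.summable]
  refine tsum_congr fun k => ?_
  rw [← ENNReal.ofReal_pow hM, ← ENNReal.ofReal_mul (by positivity)]

instance isProbabilityMeasure_compoundPoissonLaw (lam : Measure ℝ) [IsFiniteMeasure lam]
    (t : ℝ≥0) : IsProbabilityMeasure (compoundPoissonLaw lam t) := by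
  have := lintegral_exp_compoundPoissonLaw lam (c := 0) (M := lam.real Set.univ)
    measureReal_nonneg (by simp) t
  exact ⟨by simpa using this⟩

lemma charFun_compoundPoissonLaw (lam : Measure ℝ) [IsFiniteMeasure lam] (t : ℝ≥0) (u : ℝ) :
    charFun (compoundPoissonLaw lam t) u =
      Complex.exp (t * (charFun lam u - lam.real Set.univ)) := by
  have hint : Integrable (fun x => Complex.exp (inner ℝ x u * Complex.I))
      (compoundPoissonLaw lam t) :=
    (integrable_const (1 : ℝ)).mono (by fun_prop) (Eventually.of_forall fun x => by
      rw [Complex.norm_exp_ofReal_mul_I]; simp)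
  have h1 : HasSum (fun k : ℕ => ∫ x, Complex.exp (inner ℝ x u * Complex.I)
      ∂(ENNReal.ofReal (Real.exp (-(lam.real Set.univ * t)) * (t ^ k / k.factorial)) •
        convPow lam k)) (charFun (compoundPoissonLaw lam t) u) := by
    rw [charFun_apply]
    exact hasSum_integral_measure hint
  have h2 : HasSum (fun k : ℕ => Complex.exp (-(lam.real Set.univ * t)) *
      ((t * charFun lam u) ^ k / k.factorial))
      (Complex.exp (-(lam.real Set.univ * t)) * Complex.exp (t * charFun lam u)) := by
    have := (NormedSpace.expSeries_div_hasSum_exp ((t : ℂ) * charFun lam u)).mul_left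
      (Complex.exp (-(lam.real Set.univ * t)))
    rwa [← Complex.exp_eq_exp_ℂ] at this
  rw [← Complex.exp_add] at h2
  refine (h1.unique ?_).trans (congrArg Complex.exp (by ring) :
    Complex.exp (-(lam.real Set.univ * t) + t * charFun lam u) = _)
  convert! h2 using 1
  ext k
  rw [integral_smul_measure, ← charFun_apply, charFun_convPow,
    ENNReal.toReal_ofReal (by positivity), Complex.real_smul, mul_pow]
  push_cast
  ring

lemma IsCompoundPoisson.map_eq {Ω : Type*} [MeasurableSpace Ω] {P : Measure Ω}
    {X : ℝ≥0 → Ω → ℝ} {lam : Measure ℝ} (hX : IsCompoundPoisson X P lam) (t : ℝ≥0) :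
    P.map (X t) = compoundPoissonLaw lam t := by
  have := hX.finite
  have := hX.isProbabilityMeasure
  refine Measure.ext_of_charFun ?_
  ext u
  rw [hX.charFun_eq, charFun_compoundPoissonLaw, charFun_apply_real, integral_sub]
  · simp only [integral_const]
    congr 3
    · refine integral_congr_ae (Eventually.of_forall fun x => ?_)
      simp only
      congr 1; ring
    · simp
  · exact (integrable_const (1 : ℝ)).mono (by fun_prop) (by
      refine Eventually.of_forall fun x => ?_
      rw [show Complex.I * (u : ℂ) * x = ((u * x : ℝ) : ℂ) * Complex.I by push_cast; ring,
        Complex.norm_exp_ofReal_mul_I]; simp)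
  · exact integrable_const _

/-! ### Transition laws of a chain with jump measure `lam` -/

/-- Probability measures on `ℤ` bounded below by the part of the compound Poisson law that has at
most one jump. -/
structure IsStepFamily (lam : Measure ℝ) (m : ℝ≥0 → Measure ℝ) : Prop where
  prob : ∀ t, IsProbabilityMeasure (m t)
  int : ∀ t, m t (Set.range ((↑) : ℤ → ℝ))ᶜ = 0
  lower : ∀ t : ℝ≥0, ENNReal.ofReal (Real.exp (-(lam.real Set.univ * t))) •
    (Measure.dirac 0 + (t : ℝ≥0∞) • lam) ≤ m t

/-- The lower bound consists of the terms `k = 0, 1` of the Poisson series. -/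
lemma isStepFamily_compoundPoissonLaw {lam : Measure ℝ} (h : IsSkipFreeMeasure lam) :
    IsStepFamily lam (compoundPoissonLaw lam) := by
  have := h.finite
  refine ⟨fun t => inferInstance, fun t => ?_, fun t => ?_⟩
  · rw [compoundPoissonLaw, Measure.sum_apply _ measurableSet_range_intCast.compl]
    simp [convPow_int h.int]
  · refine Measure.le_iff.2 fun s hs => ?_
    rw [compoundPoissonLaw, Measure.sum_apply _ hs]
    refine le_trans (le_of_eq ?_) (ENNReal.sum_le_tsum (Finset.range 2))
    rw [Finset.sum_range_succ, Finset.sum_range_one]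
    have : convPow lam 1 = lam := by
      rw [convPow, convPow, Measure.conv_dirac]; simp
    rw [this]
    simp only [Measure.smul_apply, Measure.add_apply, smul_eq_mul, convPow, mul_add]
    rw [← mul_assoc]
    congr 2
    · simp
    · rw [ENNReal.ofReal_mul (Real.exp_pos _).le]; simp

/-- The exponentially tilted transition laws. -/
def tiltStep (lam : Measure ℝ) (m : ℝ≥0 → Measure ℝ) (c : ℝ) (t : ℝ≥0) : Measure ℝ :=
  (m t).withDensity fun x => ENNReal.ofReal (Real.exp (c * x - laplaceExponent lam c * t))

/-- The density is `e^{-ψ(c)t} e^{cx}`: the first factor turns `e^{-γt}` into `e^{-(γ + ψ(c))t}`,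
with exponent the tilted mass, and the second turns `lam` into its tilt while fixing the unit mass
at `0`. The moment hypothesis makes the tilted laws probabilities. -/
lemma isStepFamily_tiltStep {lam : Measure ℝ} (h : IsSkipFreeMeasure lam) {m : ℝ≥0 → Measure ℝ}
    (hm : IsStepFamily lam m) {c : ℝ} (hc : 0 ≤ c)
    (hexp : ∀ t : ℝ≥0, ∫⁻ x, ENNReal.ofReal (Real.exp (c * x)) ∂(m t) =
      ENNReal.ofReal (Real.exp (laplaceExponent lam c * t))) :
    IsStepFamily (tilt lam c) (tiltStep lam m c) := by
  have := h.finite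
  have hsplit : ∀ (t : ℝ≥0) (x : ℝ),
      ENNReal.ofReal (Real.exp (c * x - laplaceExponent lam c * t)) =
      ENNReal.ofReal (Real.exp (-(laplaceExponent lam c * t))) *
        ENNReal.ofReal (Real.exp (c * x)) := fun t x => by
    rw [← ENNReal.ofReal_mul (Real.exp_pos _).le, ← Real.exp_add]; ring_nf
  refine ⟨fun t => ⟨?_⟩, fun t => ?_, fun t => ?_⟩
  · rw [tiltStep, withDensity_apply _ MeasurableSet.univ, Measure.restrict_univ]
    simp_rw [hsplit]
    rw [lintegral_const_mul' _ _ ENNReal.ofReal_ne_top, hexp,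
      ← ENNReal.ofReal_mul (Real.exp_pos _).le, ← Real.exp_add]
    simp
  · exact withDensity_absolutelyContinuous _ _ (hm.int t)
  · refine Measure.le_iff.2 fun s hs => ?_
    rw [tiltStep, withDensity_apply _ hs, h.tilt_univ hc]
    refine le_trans ?_ (lintegral_mono' (Measure.restrict_mono_measure (hm.lower t) s) le_rfl)
    rw [Measure.restrict_smul, lintegral_smul_measure, Measure.restrict_add, lintegral_add_measure,
      Measure.restrict_smul, lintegral_smul_measure]
    simp_rw [hsplit]
    rw [lintegral_const_mul' _ _ ENNReal.ofReal_ne_top,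
      lintegral_const_mul' _ _ ENNReal.ofReal_ne_top, ← withDensity_apply _ hs,
      ← withDensity_apply _ hs]
    have h0 : (Measure.dirac (0 : ℝ)).withDensity (fun x => ENNReal.ofReal (Real.exp (c * x))) =
        Measure.dirac 0 := by
      ext s hs
      rw [withDensity_apply _ hs, ← lintegral_indicator hs, lintegral_dirac,
        Measure.dirac_apply' _ hs]
      by_cases h0 : (0 : ℝ) ∈ s <;> simp [h0]
    rw [h0, show -((laplaceExponent lam c + lam.real Set.univ) * (t : ℝ)) =
      -(lam.real Set.univ * t) + -(laplaceExponent lam c * t) by ring, Real.exp_add,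
      ENNReal.ofReal_mul (Real.exp_pos _).le]
    simp only [Measure.smul_apply, Measure.add_apply, smul_eq_mul, tilt]
    apply le_of_eq
    ring

lemma lintegral_exp_compoundPoissonLaw_eq {lam : Measure ℝ} (h : IsSkipFreeMeasure lam) {c : ℝ}
    (hc : 0 ≤ c) (t : ℝ≥0) :
    ∫⁻ x, ENNReal.ofReal (Real.exp (c * x)) ∂(compoundPoissonLaw lam t) =
      ENNReal.ofReal (Real.exp (laplaceExponent lam c * t)) := by
  have := h.finite
  rw [lintegral_exp_compoundPoissonLaw lam (h.laplaceExponent_add_nonneg hc) (h.lintegral_exp hc)]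
  ring_nf

/-! ### Measures on path space and dyadic grids -/

lemma measurable_eval (t : ℝ≥0) : Measurable fun w : Path => w.1 t :=
  (measurable_pi_apply t).comp measurable_subtype_coe

lemma pathFiltration_le (t : ℝ≥0) : pathFiltration t ≤ (inferInstance : MeasurableSpace Path) :=
  iSup₂_le fun s _ => (measurable_eval s).comap_le

lemma pathFiltration_mono {s t : ℝ≥0} (h : s ≤ t) : pathFiltration s ≤ pathFiltration t :=
  iSup₂_le fun u hu => le_iSup₂_of_le u (hu.trans h) le_rfl

lemma measurable_eval_pathFiltration {s t : ℝ≥0} (h : s ≤ t) :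
    Measurable[pathFiltration t] fun w : Path => w.1 s := by
  rw [measurable_iff_comap_le]
  exact le_iSup₂_of_le s h le_rfl

lemma Path.tendsto_of_le (w : Path) {t : ℝ≥0} {s : ℕ → ℝ≥0} (hs : ∀ n, t ≤ s n)
    (hlim : Tendsto s atTop (𝓝 t)) : Tendsto (fun n => w.1 (s n)) atTop (𝓝 (w.1 t)) :=
  (w.2 t).1.tendsto.comp
    (tendsto_nhdsWithin_iff.2 ⟨hlim, Eventually.of_forall hs⟩)

lemma le_ceil_mul (t : ℝ≥0) {δ : ℝ≥0} (hδ : 0 < δ) : t ≤ ⌈t / δ⌉₊ * δ := by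
  rw [← div_le_iff₀ hδ]; exact Nat.le_ceil _

lemma ceil_mul_le (t : ℝ≥0) {δ : ℝ≥0} (hδ : 0 < δ) : ⌈t / δ⌉₊ * δ ≤ t + δ := by
  have := (Nat.ceil_lt_add_one (zero_le (a := t / δ))).le
  calc (⌈t / δ⌉₊ : ℝ≥0) * δ ≤ (t / δ + 1) * δ := by gcongr
    _ = t + δ := by field_simp

lemma tendsto_div_two_pow (d : ℝ≥0) : Tendsto (fun n : ℕ => d / 2 ^ n) atTop (𝓝 0) := by
  have := (NNReal.tendsto_pow_atTop_nhds_zero_of_lt_one (r := (2⁻¹ : ℝ≥0))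
    (by rw [← NNReal.coe_lt_coe]; norm_num)).const_mul d
  simpa [div_eq_mul_inv] using this

lemma tendsto_ceil_mul (t : ℝ≥0) {δ : ℕ → ℝ≥0} (hδ : ∀ n, 0 < δ n)
    (hlim : Tendsto δ atTop (𝓝 0)) :
    Tendsto (fun n => (⌈t / δ n⌉₊ : ℝ≥0) * δ n) atTop (𝓝 t) := by
  refine tendsto_of_tendsto_of_tendsto_of_le_of_le tendsto_const_nhds (h := fun n => t + δ n) ?_
    (fun n => le_ceil_mul t (hδ n)) fun n => ceil_mul_le t (hδ n)
  simpa using hlim.const_add t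

/-- Paths with prescribed starting set and prescribed sets of increments over `M` steps of
length `δ`. -/
def gridBox (δ : ℝ≥0) (M : ℕ) (B₀ : Set ℝ) (B : ℕ → Set ℝ) : Set Path :=
  {w | w.1 0 ∈ B₀ ∧ ∀ k < M, w.1 ((k + 1 : ℕ) * δ) - w.1 (k * δ) ∈ B k}

/-- The starting point and the increments over `M` steps of length `δ`. -/
def gridIncr (δ : ℝ≥0) (M : ℕ) (w : Path) : Fin (M + 1) → ℝ :=
  Fin.cons (w.1 0) fun k : Fin M => w.1 ((k + 1 : ℕ) * δ) - w.1 (k * δ)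

lemma measurable_gridIncr (δ : ℝ≥0) (M : ℕ) : Measurable (gridIncr δ M) := by
  refine measurable_pi_lambda _ fun k => ?_
  refine Fin.cases ?_ (fun k => ?_) k
  · exact measurable_eval 0
  · exact (measurable_eval _).sub (measurable_eval _)

lemma eval_eq_sum_gridIncr (δ : ℝ≥0) (M k : ℕ) (hk : k ≤ M) (w : Path) :
    w.1 (k * δ) = ∑ i : Fin (M + 1), if (i : ℕ) ≤ k then gridIncr δ M w i else 0 := by
  have h0 : ∀ i : Fin M, (if ((i.succ : Fin (M + 1)) : ℕ) ≤ k then gridIncr δ M w i.succ else 0) =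
      (fun i : ℕ => if i < k then w.1 ((i + 1 : ℕ) * δ) - w.1 (i * δ) else 0) i := by
    intro i
    simp [gridIncr]
  rw [Fin.sum_univ_succ, Finset.sum_congr rfl fun i _ => h0 i, Fin.sum_univ_eq_sum_range
    (fun i : ℕ => if i < k then w.1 ((i + 1 : ℕ) * δ) - w.1 (i * δ) else 0) M,
    ← Finset.sum_filter, show (Finset.range M).filter (· < k) = Finset.range k by
      ext i; simp; omega,
    Finset.sum_range_sub (fun i : ℕ => w.1 (i * δ))]
  simp [gridIncr]

/-- Product sets form a π-system generating the Borel sets of the finite-dimensional space of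
increments. -/
lemma map_gridIncr_eq {ρ₁ ρ₂ : Measure Path} [IsFiniteMeasure ρ₁] (δ : ℝ≥0) (M : ℕ)
    (hbox : ∀ (B₀ : Set ℝ) (B : ℕ → Set ℝ), MeasurableSet B₀ → (∀ k, MeasurableSet (B k)) →
      ρ₁ (gridBox δ M B₀ B) = ρ₂ (gridBox δ M B₀ B)) :
    ρ₁.map (gridIncr δ M) = ρ₂.map (gridIncr δ M) := by
  have hpre : ∀ s : Fin (M + 1) → Set ℝ, gridIncr δ M ⁻¹' (Set.univ.pi s) =
      gridBox δ M (s 0) fun k => if hk : k < M then s (Fin.succ ⟨k, hk⟩) else Set.univ := by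
    intro s
    ext w
    simp only [Set.mem_preimage, Set.mem_univ_pi, gridBox, Set.mem_ofPred_eq, Fin.forall_fin_succ]
    refine and_congr (by simp [gridIncr]) ⟨fun h k hk => ?_, fun h k => ?_⟩
    · have := h ⟨k, hk⟩
      rw [gridIncr, Fin.cons_succ] at this
      simpa [hk] using this
    · simpa [gridIncr] using h k k.2
  have key : ∀ s : Fin (M + 1) → Set ℝ, (∀ i, MeasurableSet (s i)) →
      ρ₁.map (gridIncr δ M) (Set.univ.pi s) = ρ₂.map (gridIncr δ M) (Set.univ.pi s) := by
    intro s hs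
    rw [Measure.map_apply (measurable_gridIncr δ M) (MeasurableSet.univ_pi hs),
      Measure.map_apply (measurable_gridIncr δ M) (MeasurableSet.univ_pi hs), hpre]
    refine hbox _ _ (hs 0) fun k => ?_
    split_ifs
    · exact hs _
    · exact MeasurableSet.univ
  refine ext_of_generate_finite _ generateFrom_pi.symm isPiSystem_pi ?_ ?_
  · rintro _ ⟨s, hs, rfl⟩
    exact key s fun i => hs i (Set.mem_univ i)
  · have := key (fun _ => Set.univ) fun _ => MeasurableSet.univ
    simpa using this

/-- The σ-algebra of the path at the times `k d / 2 ^ n`, `k ≤ N 2 ^ n`. -/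
abbrev gridAlgebra (d : ℝ≥0) (N n : ℕ) : MeasurableSpace Path :=
  ⨆ k : ℕ, ⨆ _ : k ≤ N * 2 ^ n, MeasurableSpace.comap (fun w : Path => w.1 (k * (d / 2 ^ n)))
    inferInstance

lemma gridAlgebra_mono (d : ℝ≥0) (N : ℕ) : Monotone (gridAlgebra d N) := by
  refine monotone_nat_of_le_succ fun n => iSup₂_le fun k hk => ?_
  refine le_iSup₂_of_le (2 * k) (by rw [pow_succ, ← mul_assoc]; omega) (le_of_eq ?_)
  congr 1
  ext w
  push_cast
  rw [pow_succ]
  field_simp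

lemma gridAlgebra_le_comap (d : ℝ≥0) (N n : ℕ) :
    gridAlgebra d N n ≤ MeasurableSpace.comap (gridIncr (d / 2 ^ n) (N * 2 ^ n)) inferInstance := by
  refine iSup₂_le fun k hk => ?_
  rw [← measurable_iff_comap_le]
  simp_rw [eval_eq_sum_gridIncr (d / 2 ^ n) _ k hk]
  refine Finset.measurable_sum _ fun i _ => ?_
  split_ifs
  · exact (measurable_pi_apply i).comp (comap_measurable _)
  · exact measurable_const

lemma gridAlgebra_le (d : ℝ≥0) (N n : ℕ) : gridAlgebra d N n ≤ pathFiltration (N * d) := by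
  refine iSup₂_le fun k hk => ?_
  refine le_iSup₂_of_le (k * (d / 2 ^ n)) ?_ le_rfl
  have : (k : ℝ≥0) ≤ N * 2 ^ n := by exact_mod_cast hk
  calc (k : ℝ≥0) * (d / 2 ^ n) ≤ (N * 2 ^ n) * (d / 2 ^ n) := by gcongr
    _ = N * d := by field_simp

/-- By right-continuity the value at `s` is the limit of the values at `s` rounded up to the grid.
Since the horizon `N d` is itself a grid point, rounding up stays within it. -/
lemma pathFiltration_eq_iSup_gridAlgebra (d : ℝ≥0) (N : ℕ) :
    pathFiltration (N * d) = ⨆ n, gridAlgebra d N n := by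
  refine le_antisymm (iSup₂_le fun s hs => ?_) (iSup_le fun n => gridAlgebra_le d N n)
  rw [← measurable_iff_comap_le]
  have hgrid : ∀ n k : ℕ, k ≤ N * 2 ^ n →
      Measurable[⨆ n, gridAlgebra d N n] fun w : Path => w.1 (k * (d / 2 ^ n)) := by
    intro n k hk
    rw [measurable_iff_comap_le]
    exact le_iSup_of_le n (le_iSup₂_of_le (f := fun (k : ℕ) (_ : k ≤ N * 2 ^ n) =>
      MeasurableSpace.comap (fun w : Path => w.1 (k * (d / 2 ^ n))) inferInstance) k hk le_rfl)
  rcases eq_or_ne d 0 with rfl | hd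
  · have : s = 0 := by simpa using hs
    subst this
    simpa using hgrid 0 0 (by simp)
  · have hd' : 0 < d := pos_iff_ne_zero.2 hd
    have hδ : ∀ n : ℕ, 0 < d / 2 ^ n := fun n => by positivity
    refine @measurable_of_tendsto_metrizable Path ℝ (⨆ n, gridAlgebra d N n) _ _ _ _
      (fun n w => w.1 (⌈s / (d / 2 ^ n)⌉₊ * (d / 2 ^ n))) _ (fun n => hgrid n _ ?_) ?_
    · rw [Nat.ceil_le]
      push_cast
      rw [div_le_iff₀ (hδ n)]
      calc s ≤ N * d := hs
        _ = _ := by field_simp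
    · exact tendsto_pi_nhds.2 fun w => w.tendsto_of_le (fun n => le_ceil_mul s (hδ n))
        (tendsto_ceil_mul s hδ (tendsto_div_two_pow d))

/-- Finite measures which agree on all dyadic boxes agree on the natural filtration. -/
lemma measure_eq_of_gridBox {ρ₁ ρ₂ : Measure Path} [IsFiniteMeasure ρ₁] (d : ℝ≥0) (N : ℕ)
    (hbox : ∀ (n : ℕ) (B₀ : Set ℝ) (B : ℕ → Set ℝ), MeasurableSet B₀ →
      (∀ k, MeasurableSet (B k)) →
      ρ₁ (gridBox (d / 2 ^ n) (N * 2 ^ n) B₀ B) = ρ₂ (gridBox (d / 2 ^ n) (N * 2 ^ n) B₀ B))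
    {A : Set Path} (hA : MeasurableSet[pathFiltration (N * d)] A) : ρ₁ A = ρ₂ A := by
  have hle := pathFiltration_le (N * d)
  have hgrid : ∀ n (A : Set Path), MeasurableSet[gridAlgebra d N n] A → ρ₁ A = ρ₂ A := by
    intro n A hA
    obtain ⟨S, hS, rfl⟩ := gridAlgebra_le_comap d N n A hA
    rw [← Measure.map_apply (measurable_gridIncr _ _) hS, map_gridIncr_eq _ _ (hbox n),
      Measure.map_apply (measurable_gridIncr _ _) hS]
  have htrim : ρ₁.trim hle = ρ₂.trim hle := by
    have : IsFiniteMeasure (ρ₁.trim hle) := isFiniteMeasure_trim hle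
    refine @ext_of_generate_finite Path (pathFiltration (N * d)) _ _
      (⋃ n, {s | MeasurableSet[gridAlgebra d N n] s}) ?_ ?_ this ?_ ?_
    -- The grid σ-algebras increase with `n`, so their union is a π-system generating the natural
    -- filtration.
    · rw [pathFiltration_eq_iSup_gridAlgebra]
      exact (MeasurableSpace.generateFrom_iUnion_measurableSet _).symm
    · exact isPiSystem_iUnion_of_monotone _
        (fun n => (gridAlgebra d N n).isPiSystem_measurableSet)
        fun n m hnm s hs => gridAlgebra_mono d N hnm s hs
    · intro s hs
      obtain ⟨n, hn⟩ := Set.mem_iUnion.1 hs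
      rw [trim_measurableSet_eq hle (gridAlgebra_le d N n s hn),
        trim_measurableSet_eq hle (gridAlgebra_le d N n s hn)]
      exact hgrid n s hn
    · rw [trim_measurableSet_eq hle MeasurableSet.univ, trim_measurableSet_eq hle MeasurableSet.univ]
      exact hgrid 0 _ MeasurableSet.univ
  rw [← trim_measurableSet_eq hle hA, htrim, trim_measurableSet_eq hle hA]

/-! ### Path measures with stationary independent increments -/

/-- The increments of the coordinate process up to time `T` are independent of the past, with
laws `m`. -/
def HasIncrements (ρ : Measure Path) (m : ℝ≥0 → Measure ℝ) (T : ℝ≥0) : Prop :=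
  ∀ s δ : ℝ≥0, s + δ ≤ T → ∀ A : Set Path, MeasurableSet[pathFiltration s] A →
    ∀ B : Set ℝ, MeasurableSet B →
      ρ (A ∩ {w | w.1 (s + δ) - w.1 s ∈ B}) = ρ A * m δ B

/-- The law of a process started at `0`, with stationary independent increments of laws `m`. -/
structure IsIncrementLaw (ν : Measure Path) (m : ℝ≥0 → Measure ℝ) : Prop where
  prob : IsProbabilityMeasure ν
  start : ∀ᵐ w ∂ν, w.1 0 = 0
  incr : ∀ T, HasIncrements ν m T

lemma measurableSet_incr {s t T : ℝ≥0} (hs : s ≤ T) (ht : t ≤ T) {B : Set ℝ}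
    (hB : MeasurableSet B) : MeasurableSet[pathFiltration T] {w : Path | w.1 t - w.1 s ∈ B} :=
  ((measurable_eval_pathFiltration ht).sub (measurable_eval_pathFiltration hs)) hB

lemma measurableSet_gridBox (δ : ℝ≥0) (M : ℕ) {B₀ : Set ℝ} {B : ℕ → Set ℝ}
    (hB₀ : MeasurableSet B₀) (hB : ∀ k, MeasurableSet (B k)) :
    MeasurableSet[pathFiltration (M * δ)] (gridBox δ M B₀ B) := by
  rw [gridBox, Set.ofPred_and]
  refine MeasurableSet.inter ((measurable_eval_pathFiltration zero_le) hB₀) ?_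
  rw [Set.ofPred_forall]
  refine MeasurableSet.iInter fun k => ?_
  rw [Set.ofPred_forall]
  refine MeasurableSet.iInter fun hk => ?_
  refine measurableSet_incr ?_ ?_ (hB k)
  · gcongr
  · gcongr; exact_mod_cast hk

lemma gridBox_succ (δ : ℝ≥0) (M : ℕ) (B₀ : Set ℝ) (B : ℕ → Set ℝ) :
    gridBox δ (M + 1) B₀ B =
      gridBox δ M B₀ B ∩ {w | w.1 (M * δ + δ) - w.1 (M * δ) ∈ B M} := by
  ext w
  simp only [gridBox, Set.mem_inter_iff, Set.mem_ofPred_eq, Nat.forall_lt_succ_right]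
  rw [and_assoc]
  push_cast
  rw [add_mul, one_mul]

lemma HasIncrements.gridBox {ρ : Measure Path} {m : ℝ≥0 → Measure ℝ} {T : ℝ≥0}
    (h : HasIncrements ρ m T) (δ : ℝ≥0) (M : ℕ) (hM : M * δ ≤ T) {B₀ : Set ℝ} {B : ℕ → Set ℝ}
    (hB₀ : MeasurableSet B₀) (hB : ∀ k, MeasurableSet (B k)) :
    ρ (gridBox δ M B₀ B) = ρ {w | w.1 0 ∈ B₀} * ∏ k ∈ Finset.range M, m δ (B k) := by
  induction M with
  | zero => simp [SkipFree.gridBox]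
  | succ M ih =>
    have hM' : (M : ℝ≥0) * δ + δ ≤ T := by
      refine le_trans (le_of_eq ?_) hM; push_cast; ring
    rw [gridBox_succ, h _ _ hM' _ (measurableSet_gridBox δ M hB₀ hB) _ (hB M),
      ih (le_trans (le_add_of_nonneg_right zero_le) hM'), Finset.prod_range_succ, mul_assoc]

/-- Paths start at `0` almost surely, so the condition on the starting point is a factor `0` or `1`.
-/
lemma measure_gridBox_inter {ν : Measure Path} (hν : ∀ᵐ w ∂ν, w.1 0 = 0) (δ : ℝ≥0) (M : ℕ)
    (B₀ : Set ℝ) (B : ℕ → Set ℝ) (I : Set Path) :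
    ν (gridBox δ M B₀ B ∩ I) =
      Set.indicator B₀ 1 0 * ν (gridBox δ M Set.univ B ∩ I) := by
  by_cases h0 : (0 : ℝ) ∈ B₀
  · rw [Set.indicator_of_mem h0, Pi.one_apply, one_mul]
    refine measure_congr ?_
    filter_upwards [hν] with w hw
    change (w ∈ _ ∩ I) = (w ∈ _ ∩ I)
    simp [gridBox, hw, h0]
  · rw [Set.indicator_of_notMem h0, zero_mul]
    refine measure_mono_null (fun w hw => ?_) (ae_iff.1 hν)
    intro h
    refine h0 ?_
    have := hw.1.1
    rwa [h] at this

/-! ### The path law of a compound Poisson process -/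

section Law

variable {Ω : Type*} [MeasurableSpace Ω] {P : Measure Ω} {X : ℝ≥0 → Ω → ℝ}

lemma measurable_path (hX : IsLevyProcess X P) :
    Measurable (fun ω => (⟨fun t => X t ω, hX.cadlag ω⟩ : Path)) :=
  (measurable_pi_lambda _ hX.measurable).subtype_mk

lemma IsLevyProcess.prob_gridBox_inter (hX : IsLevyProcess X P) (s δ : ℝ≥0) (n : ℕ)
    {B : ℕ → Set ℝ} (hB : ∀ k, MeasurableSet (B k)) {C : Set ℝ} (hC : MeasurableSet C) :
    P ({ω | ∀ k < 2 ^ n, X ((k + 1 : ℕ) * (s / 2 ^ n)) ω - X (k * (s / 2 ^ n)) ω ∈ B k} ∩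
        {ω | X (s + δ) ω - X s ω ∈ C}) =
      P {ω | ∀ k < 2 ^ n, X ((k + 1 : ℕ) * (s / 2 ^ n)) ω - X (k * (s / 2 ^ n)) ω ∈ B k} *
        P {ω | X (s + δ) ω - X s ω ∈ C} := by
  -- The grid on `[0, s]` followed by the constant time `s + δ`: the last relevant increment is the
  -- one over `[s, s + δ]`. Comparing the product formulas with and without it gives the claim.
  let t : ℕ → ℝ≥0 := fun k => if k ≤ 2 ^ n then k * (s / 2 ^ n) else s + δ
  have hle : ∀ k : ℕ, k ≤ 2 ^ n → t k = k * (s / 2 ^ n) := fun k hk => by simp [t, hk]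
  have htop : t (2 ^ n) = s := by
    rw [hle _ le_rfl]; push_cast; field_simp
  have hlast : t (2 ^ n + 1) = s + δ := by simp [t]
  have hmono : Monotone t := by
    refine monotone_nat_of_le_succ fun k => ?_
    rcases lt_trichotomy k (2 ^ n) with h | h | h
    · rw [hle k h.le, hle (k + 1) h]
      gcongr; simp
    · rw [h, htop, hlast]; simp
    · simp [t, not_le.2 h, not_le.2 (h.trans (Nat.lt_succ_self k))]
  let D : ℕ → Set ℝ := fun k => if k < 2 ^ n then B k else C
  have hD : ∀ k, MeasurableSet (D k) := fun k => by
    simp only [D]; split_ifs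
    exacts [hB k, hC]
  have hind := hX.indep.nat hmono
  have h1 := hind.measure_inter_preimage_eq_mul (Finset.range (2 ^ n)) (sets := D)
    fun k _ => hD k
  have h2 := hind.measure_inter_preimage_eq_mul (Finset.range (2 ^ n + 1)) (sets := D)
    fun k _ => hD k
  have e1 : (⋂ i ∈ Finset.range (2 ^ n), (fun ω => X (t (i + 1)) ω - X (t i) ω) ⁻¹' D i) =
      {ω | ∀ k < 2 ^ n, X ((k + 1 : ℕ) * (s / 2 ^ n)) ω - X (k * (s / 2 ^ n)) ω ∈ B k} := by
    ext ω
    simp only [Set.mem_iInter, Finset.mem_range, Set.mem_preimage, Set.mem_ofPred_eq]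
    refine forall₂_congr fun k hk => ?_
    rw [hle k hk.le, hle (k + 1) hk]
    simp [D, hk]
  have e2 : (fun ω => X (t (2 ^ n + 1)) ω - X (t (2 ^ n)) ω) ⁻¹' D (2 ^ n) =
      {ω | X (s + δ) ω - X s ω ∈ C} := by
    rw [htop, hlast]; simp [D]; rfl
  rw [Finset.prod_range_succ, ← h1, e1, e2, Finset.range_add_one, Finset.set_biInter_insert, e1, e2,
    Set.inter_comm] at h2
  exact h2

lemma IsCompoundPoisson.isIncrementLaw {lam : Measure ℝ} (hX : IsCompoundPoisson X P lam)
    (hc : ∀ ω, IsCadlag (fun t => X t ω)) :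
    IsIncrementLaw (pathLaw X hc P) (compoundPoissonLaw lam) := by
  have hP := hX.isProbabilityMeasure
  have hm := measurable_path hX.toIsLevyProcess
  have hstart : ∀ᵐ w ∂(pathLaw X hc P), w.1 0 = 0 := by
    exact (ae_map_iff hm.aemeasurable ((measurable_eval 0) (measurableSet_singleton 0))).2 hX.start
  have hprob : IsProbabilityMeasure (pathLaw X hc P) := Measure.isProbabilityMeasure_map hm.aemeasurable
  refine ⟨hprob, hstart, fun T s δ _ A hA C hC => ?_⟩
  set I : Set Path := {w | w.1 (s + δ) - w.1 s ∈ C} with hI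
  have hIm : MeasurableSet I := ((measurable_eval _).sub (measurable_eval _)) hC
  have hIν : pathLaw X hc P I = compoundPoissonLaw lam δ C := by
    rw [pathLaw, Measure.map_apply hm hIm, ← hX.map_eq, ← (hX.stationary s δ).map_eq]
    exact (Measure.map_apply ((hX.measurable _).sub (hX.measurable _)) hC).symm
  -- Independence from finitely many grid increments extends to the whole past: the two measures
  -- agree on boxes, hence on the σ-algebra at time `s`.
  have key := measure_eq_of_gridBox (ρ₁ := (pathLaw X hc P).restrict I)
    (ρ₂ := (pathLaw X hc P I) • pathLaw X hc P) s 1 (fun n B₀ B hB₀ hB => ?_) (A := A)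
    (by rwa [Nat.cast_one, one_mul])
  · rw [Measure.restrict_apply (pathFiltration_le s _ hA), Measure.smul_apply, smul_eq_mul,
      mul_comm, hIν] at key
    exact key
  · have hbox := pathFiltration_le _ _ (measurableSet_gridBox (s / 2 ^ n) (1 * 2 ^ n) hB₀ hB)
    have hbox' := pathFiltration_le _ _
      (measurableSet_gridBox (s / 2 ^ n) (1 * 2 ^ n) MeasurableSet.univ hB)
    have e := measure_gridBox_inter hstart (s / 2 ^ n) (1 * 2 ^ n) B₀ B Set.univ
    rw [Set.inter_univ, Set.inter_univ] at e
    rw [Measure.restrict_apply hbox, Measure.smul_apply, smul_eq_mul,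
      measure_gridBox_inter hstart, e, mul_left_comm]
    congr 1
    rw [pathLaw, Measure.map_apply hm (hbox'.inter hIm), Measure.map_apply hm hbox',
      Measure.map_apply hm hIm]
    have := (hX.prob_gridBox_inter s δ n hB hC).trans (mul_comm _ _)
    simpa [gridBox, hI] using this

end Law

/-! ### Exponential change of measure on path space -/

section Tilt

variable {ν : Measure Path} {m : ℝ≥0 → Measure ℝ} {lam : Measure ℝ} {c : ℝ}

/-- The exponential change of measure up to time `t`. -/
def tiltPath (lam : Measure ℝ) (ν : Measure Path) (c : ℝ) (t : ℝ≥0) : Measure Path :=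
  ν.withDensity fun w => ENNReal.ofReal (Real.exp (c * w.1 t - laplaceExponent lam c * t))

lemma IsIncrementLaw.indep (h : IsIncrementLaw ν m) (s δ : ℝ≥0) :
    Indep (pathFiltration s)
      (MeasurableSpace.comap (fun w : Path => w.1 (s + δ) - w.1 s) inferInstance) ν := by
  have := h.prob
  rw [Indep_iff]
  rintro A _ hA ⟨B, hB, rfl⟩
  have h1 := h.incr (s + δ) s δ le_rfl A hA B hB
  have h2 := h.incr (s + δ) s δ le_rfl Set.univ MeasurableSet.univ B hB
  rw [measure_univ, one_mul, Set.univ_inter] at h2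
  rw [← h2] at h1
  exact h1

lemma IsIncrementLaw.map_incr (h : IsIncrementLaw ν m) (s δ : ℝ≥0) :
    ν.map (fun w : Path => w.1 (s + δ) - w.1 s) = m δ := by
  have := h.prob
  ext B hB
  refine (Measure.map_apply ((measurable_eval _).sub (measurable_eval _)) hB).trans ?_
  have h2 := h.incr (s + δ) s δ le_rfl Set.univ MeasurableSet.univ B hB
  rwa [measure_univ, one_mul, Set.univ_inter] at h2

/-- The density at time `s + δ` is the density at time `s` times a function of the increment, and
the increment is independent of the past. -/
lemma IsIncrementLaw.tiltPath_inter (h : IsIncrementLaw ν m) (s δ : ℝ≥0) {A : Set Path}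
    (hA : MeasurableSet[pathFiltration s] A) {B : Set ℝ} (hB : MeasurableSet B) :
    tiltPath lam ν c (s + δ) (A ∩ {w | w.1 (s + δ) - w.1 s ∈ B}) =
      tiltPath lam ν c s A * tiltStep lam m c δ B := by
  have hA' := pathFiltration_le s _ hA
  have hincr : Measurable fun w : Path => w.1 (s + δ) - w.1 s :=
    (measurable_eval _).sub (measurable_eval _)
  have hI : MeasurableSet {w : Path | w.1 (s + δ) - w.1 s ∈ B} := hincr hB
  let f : Path → ℝ≥0∞ := A.indicator fun w =>
    ENNReal.ofReal (Real.exp (c * w.1 s - laplaceExponent lam c * s))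
  let g : ℝ → ℝ≥0∞ := B.indicator fun x =>
    ENNReal.ofReal (Real.exp (c * x - laplaceExponent lam c * δ))
  have hg : Measurable g := Measurable.indicator (by fun_prop) hB
  have hf : Measurable[pathFiltration s] f := by
    refine Measurable.indicator ?_ hA
    have := measurable_eval_pathFiltration (le_refl s)
    exact ENNReal.measurable_ofReal.comp (Real.measurable_exp.comp
      ((measurable_const.mul this).sub measurable_const))
  rw [tiltPath, tiltPath, tiltStep, withDensity_apply _ (hA'.inter hI), withDensity_apply _ hA',
    withDensity_apply _ hB, ← lintegral_indicator (hA'.inter hI), ← lintegral_indicator hA',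
    ← lintegral_indicator hB, ← h.map_incr s δ, lintegral_map hg hincr]
  refine Eq.trans ?_ (lintegral_mul_eq_lintegral_mul_lintegral_of_independent_measurableSpace
    (pathFiltration_le s) hincr.comap_le (h.indep s δ) hf (hg.comp (comap_measurable _)))
  refine lintegral_congr fun w => ?_
  by_cases h1 : w ∈ A <;> by_cases h2 : w.1 (s + δ) - w.1 s ∈ B <;>
    simp [g, h1, h2]
  rw [← ENNReal.ofReal_mul (Real.exp_pos _).le, ← Real.exp_add]
  congr 2
  ring

/-- The martingale property of the density: the tilted increments have total mass one, so the
changes of measure at different times are consistent. -/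
lemma IsIncrementLaw.tiltPath_eq (h : IsIncrementLaw ν m)
    (hprob : ∀ t, IsProbabilityMeasure (tiltStep lam m c t)) {s t : ℝ≥0} (hst : s ≤ t)
    {A : Set Path} (hA : MeasurableSet[pathFiltration s] A) :
    tiltPath lam ν c t A = tiltPath lam ν c s A := by
  have := h.tiltPath_inter (lam := lam) (c := c) s (t - s) hA MeasurableSet.univ
  have hp := hprob (t - s)
  rw [add_tsub_cancel_of_le hst, measure_univ, mul_one] at this
  simpa using this

lemma IsIncrementLaw.hasIncrements_tiltPath (h : IsIncrementLaw ν m)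
    (hprob : ∀ t, IsProbabilityMeasure (tiltStep lam m c t)) (T : ℝ≥0) :
    HasIncrements (tiltPath lam ν c T) (tiltStep lam m c) T := by
  intro s δ hT A hA B hB
  have hsT : s ≤ T := (le_add_of_nonneg_right zero_le).trans hT
  rw [h.tiltPath_eq hprob hsT hA, h.tiltPath_eq hprob hT, h.tiltPath_inter s δ hA hB]
  exact (pathFiltration_mono (le_add_of_nonneg_right zero_le) _ hA).inter
    (measurableSet_incr (le_add_of_nonneg_right zero_le) le_rfl hB)

lemma IsIncrementLaw.start_tiltPath (h : IsIncrementLaw ν m) (t : ℝ≥0) :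
    ∀ᵐ w ∂(tiltPath lam ν c t), w.1 0 = 0 :=
  (withDensity_absolutelyContinuous _ _).ae_le h.start

lemma IsIncrementLaw.isProbabilityMeasure_tiltPath (h : IsIncrementLaw ν m)
    (hprob : ∀ t, IsProbabilityMeasure (tiltStep lam m c t)) (t : ℝ≥0) :
    IsProbabilityMeasure (tiltPath lam ν c t) := by
  have := h.prob
  refine ⟨?_⟩
  rw [h.tiltPath_eq hprob zero_le MeasurableSet.univ, tiltPath,
    withDensity_apply _ MeasurableSet.univ, Measure.restrict_univ,
    lintegral_congr_ae (g := fun _ => 1)]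
  · simp
  · filter_upwards [h.start] with w hw
    simp [hw]

end Tilt

/-! ### Concatenation of paths and existence of the exponential change of measure -/

/-- The path whose increments over `[n, n + 1]` are those of `x n` over `[0, 1]`. -/
def concFun (x : ℕ → Path) (t : ℝ≥0) : ℝ :=
  ∑ i ∈ Finset.range ⌊t⌋₊, ((x i).1 1 - (x i).1 0) +
    ((x ⌊t⌋₊).1 (t - ⌊t⌋₊) - (x ⌊t⌋₊).1 0)

/-- The endpoint `u = 1` is included: there the floor is already `n + 1`, and the new summand is the
full increment of the `n`-th piece. Adjacent pieces thus match at integer times. -/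
lemma concFun_add (x : ℕ → Path) (n : ℕ) {u : ℝ≥0} (hu : u ≤ 1) :
    concFun x (n + u) =
      ∑ i ∈ Finset.range n, ((x i).1 1 - (x i).1 0) + ((x n).1 u - (x n).1 0) := by
  rcases hu.lt_or_eq with hu | rfl
  · have hfl : ⌊(n : ℝ≥0) + u⌋₊ = n := by
      rw [Nat.floor_eq_iff (zero_le)]
      exact ⟨le_add_of_nonneg_right zero_le, by gcongr⟩
    rw [concFun, hfl, add_tsub_cancel_left]
  · have hfl : ⌊(n : ℝ≥0) + 1⌋₊ = n + 1 := by
      rw [← Nat.cast_succ, Nat.floor_natCast]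
    rw [concFun, hfl, Finset.sum_range_succ]
    simp

lemma concFun_eq (x : ℕ → Path) (n : ℕ) {t : ℝ≥0} (h1 : (n : ℝ≥0) ≤ t) (h2 : t ≤ n + 1) :
    concFun x t =
      ∑ i ∈ Finset.range n, ((x i).1 1 - (x i).1 0) + ((x n).1 (t - n) - (x n).1 0) := by
  have := concFun_add x n (u := t - n) (by rwa [tsub_le_iff_left])
  rwa [add_tsub_cancel_of_le h1] at this

lemma isCadlag_concFun (x : ℕ → Path) : IsCadlag (concFun x) := by
  intro t
  constructor
  · set n := ⌊t⌋₊ with hn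
    have hnt : (n : ℝ≥0) ≤ t := Nat.floor_le zero_le
    have htn : t < n + 1 := Nat.lt_floor_add_one t
    have hshift : ContinuousWithinAt (fun r : ℝ≥0 => (x n).1 (r - n)) (Set.Ici t) t :=
      ((x n).2 (t - n)).1.comp (t := Set.Ici (t - n)) (f := fun r : ℝ≥0 => r - n)
        (by fun_prop) fun r (hr : t ≤ r) => tsub_le_tsub_right hr _
    refine ContinuousWithinAt.congr_of_eventuallyEq
      ((hshift.sub (continuousWithinAt_const (b := (x n).1 0))).const_add
        (∑ i ∈ Finset.range n, ((x i).1 1 - (x i).1 0))) ?_ (concFun_eq x n hnt htn.le)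
    filter_upwards [self_mem_nhdsWithin, mem_nhdsWithin_of_mem_nhds (Iio_mem_nhds htn)]
      with r hr1 hr2
    exact concFun_eq x n (hnt.trans hr1) (le_of_lt hr2)
  · rcases eq_or_ne t 0 with rfl | ht
    -- No times lie below `0`, so the left-limit condition is empty and any value serves.
    · refine ⟨0, ?_⟩
      simp
    -- Left limits use the piece with `n < t ≤ n + 1`, found by the ceiling; right-continuity used
    -- the floor.
    · obtain ⟨n, hn⟩ : ∃ n, ⌈t⌉₊ = n + 1 :=
        Nat.exists_eq_succ_of_ne_zero (by simpa using ht)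
      have h1 : (n : ℝ≥0) < t := by rw [← Nat.lt_ceil, hn]; omega
      have h2 : t ≤ n + 1 := by
        have := Nat.le_ceil t
        rw [hn] at this; exact_mod_cast this
      obtain ⟨l, hl⟩ := ((x n).2 (t - n)).2
      have hshift : Tendsto (fun r : ℝ≥0 => r - n) (𝓝[<] t) (𝓝[<] (t - n)) := by
        refine tendsto_nhdsWithin_iff.2 ⟨?_, ?_⟩
        · exact (Continuous.tendsto (by fun_prop) t).mono_left nhdsWithin_le_nhds
        · filter_upwards [self_mem_nhdsWithin, mem_nhdsWithin_of_mem_nhds (Ioi_mem_nhds h1)]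
            with r hr1 hr2
          exact tsub_lt_tsub_right_of_le (le_of_lt hr2) (Set.mem_Iio.1 hr1)
      refine ⟨_, (((hl.comp hshift).sub_const ((x n).1 0)).const_add
        (∑ i ∈ Finset.range n, ((x i).1 1 - (x i).1 0))).congr' ?_⟩
      filter_upwards [self_mem_nhdsWithin, mem_nhdsWithin_of_mem_nhds (Ioi_mem_nhds h1)]
        with r hr1 hr2
      exact (concFun_eq x n (le_of_lt hr2) ((le_of_lt hr1).trans h2)).symm

/-- Concatenation of paths. -/
def conc (x : ℕ → Path) : Path := ⟨concFun x, isCadlag_concFun x⟩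

lemma measurable_conc : Measurable conc := by
  refine Measurable.subtype_mk (measurable_pi_lambda _ fun t => ?_)
  have h : ∀ (i : ℕ) (s : ℝ≥0), Measurable fun x : ℕ → Path => (x i).1 s := fun i s =>
    (measurable_eval s).comp (measurable_pi_apply i)
  exact (Finset.measurable_sum _ fun i _ => (h i 1).sub (h i 0)).add ((h _ _).sub (h _ _))

lemma conc_grid (x : ℕ → Path) (n i j : ℕ) (hj : j ≤ 2 ^ n) :
    (conc x).1 ((i * 2 ^ n + j : ℕ) * (1 / 2 ^ n)) =
      ∑ i ∈ Finset.range i, ((x i).1 1 - (x i).1 0) +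
        ((x i).1 (j * (1 / 2 ^ n)) - (x i).1 0) := by
  have h1 : ((i * 2 ^ n + j : ℕ) : ℝ≥0) * (1 / 2 ^ n) = i + j * (1 / 2 ^ n) := by
    push_cast; field_simp
  rw [h1]
  refine concFun_add x i ?_
  rw [mul_one_div, div_le_one (by positivity)]
  exact_mod_cast hj

lemma conc_mem_gridBox (x : ℕ → Path) (n N : ℕ) (B₀ : Set ℝ) (B : ℕ → Set ℝ) :
    conc x ∈ gridBox (1 / 2 ^ n) (N * 2 ^ n) B₀ B ↔ (0 : ℝ) ∈ B₀ ∧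
      ∀ i < N, x i ∈ gridBox (1 / 2 ^ n) (2 ^ n) Set.univ fun j => B (i * 2 ^ n + j) := by
  have h0 : (conc x).1 0 = 0 := by simp [conc, concFun]
  have hinc : ∀ i j : ℕ, j < 2 ^ n →
      (conc x).1 ((i * 2 ^ n + j + 1 : ℕ) * (1 / 2 ^ n)) -
        (conc x).1 ((i * 2 ^ n + j : ℕ) * (1 / 2 ^ n)) =
      (x i).1 ((j + 1 : ℕ) * (1 / 2 ^ n)) - (x i).1 (j * (1 / 2 ^ n)) := by
    intro i j hj
    rw [add_assoc, conc_grid x n i j hj.le, conc_grid x n i (j + 1) hj]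
    ring
  simp only [gridBox, Set.mem_ofPred_eq, h0, Set.mem_univ, true_and]
  refine and_congr Iff.rfl ⟨fun h i hi j hj => ?_, fun h k hk => ?_⟩
  · rw [← hinc i j hj]
    refine h _ ?_
    calc i * 2 ^ n + j < (i + 1) * 2 ^ n := by rw [add_mul]; omega
      _ ≤ N * 2 ^ n := Nat.mul_le_mul_right _ hi
  · have hk' : k / 2 ^ n * 2 ^ n + k % 2 ^ n = k := Nat.div_add_mod' k (2 ^ n)
    have hmod : k % 2 ^ n < 2 ^ n := Nat.mod_lt _ (by positivity)
    have := h (k / 2 ^ n) ((Nat.div_lt_iff_lt_mul (by positivity)).2 hk) (k % 2 ^ n) hmod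
    rw [← hinc _ _ hmod, hk'] at this
    exact this

lemma prod_range_mul_eq {M : Type*} [CommMonoid M] (f : ℕ → M) (N K : ℕ) :
    ∏ k ∈ Finset.range (N * K), f k =
      ∏ i ∈ Finset.range N, ∏ j ∈ Finset.range K, f (i * K + j) := by
  induction N with
  | zero => simp
  | succ N ih => rw [Nat.succ_mul, Finset.prod_range_add, ih, Finset.prod_range_succ]

section Exist

variable {ν : Measure Path} {m : ℝ≥0 → Measure ℝ} {lam : Measure ℝ} {c : ℝ}

lemma measure_start_mem {ρ : Measure Path} (hρ : IsProbabilityMeasure ρ)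
    (hstart : ∀ᵐ w ∂ρ, w.1 0 = 0) (B₀ : Set ℝ) :
    ρ {w | w.1 0 ∈ B₀} = Set.indicator B₀ 1 0 := by
  have := measure_gridBox_inter hstart 0 0 B₀ (fun _ => Set.univ) Set.univ
  simpa [gridBox] using this

/-- Independent copies of the path tilted up to time `1` are concatenated. The result and the path
tilted up to a longer integer time give every dyadic box the same product of step probabilities, so
they agree on the natural filtration. -/
lemma IsIncrementLaw.exists_expChange (h : IsIncrementLaw ν m)
    (hprob : ∀ t, IsProbabilityMeasure (tiltStep lam m c t)) :
    ∃ νc, IsExpChange lam ν c νc := by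
  have hp := h.isProbabilityMeasure_tiltPath (lam := lam) (c := c) hprob
  let Q : Measure (ℕ → Path) := Measure.infinitePi fun _ : ℕ => tiltPath lam ν c 1
  have hQ : IsProbabilityMeasure (Q.map conc) :=
    Measure.isProbabilityMeasure_map measurable_conc.aemeasurable
  refine ⟨Q.map conc, fun t Λ hΛ => ?_⟩
  have htN : t ≤ (⌈t⌉₊ : ℝ≥0) * 1 := by rw [mul_one]; exact Nat.le_ceil t
  have key := measure_eq_of_gridBox (ρ₁ := Q.map conc) (ρ₂ := tiltPath lam ν c (⌈t⌉₊ * 1)) 1 ⌈t⌉₊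
    (fun n B₀ B hB₀ hB => ?_) (pathFiltration_mono htN Λ hΛ)
  · rw [key, h.tiltPath_eq hprob htN hΛ, tiltPath, withDensity_apply _ (pathFiltration_le t _ hΛ)]
  · have hbox := pathFiltration_le _ _
      (measurableSet_gridBox (1 / 2 ^ n) (⌈t⌉₊ * 2 ^ n) hB₀ hB)
    have hpre : conc ⁻¹' gridBox (1 / 2 ^ n) (⌈t⌉₊ * 2 ^ n) B₀ B =
        {_x | (0 : ℝ) ∈ B₀} ∩ Set.pi (Finset.range ⌈t⌉₊) fun i =>
          gridBox (1 / 2 ^ n) (2 ^ n) Set.univ fun j => B (i * 2 ^ n + j) := by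
      ext x
      rw [Set.mem_preimage, conc_mem_gridBox]
      simp [Set.mem_pi]
    have hstep1 : ((2 ^ n : ℕ) : ℝ≥0) * (1 / 2 ^ n) ≤ 1 := by push_cast; field_simp; exact le_rfl
    have hstepN : ((⌈t⌉₊ * 2 ^ n : ℕ) : ℝ≥0) * (1 / 2 ^ n) ≤ ⌈t⌉₊ * 1 := by
      push_cast; field_simp; exact le_rfl
    rw [Measure.map_apply measurable_conc hbox, hpre,
      (h.hasIncrements_tiltPath hprob _).gridBox _ _ hstepN hB₀ hB, prod_range_mul_eq,
      measure_start_mem (hp _) (h.start_tiltPath _)]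
    by_cases h0 : (0 : ℝ) ∈ B₀
    · rw [Set.indicator_of_mem h0, Pi.one_apply, one_mul]
      simp only [h0, Set.ofPred_true, Set.univ_inter]
      rw [Measure.infinitePi_pi _ fun i _ => pathFiltration_le _ _
        (measurableSet_gridBox _ _ MeasurableSet.univ fun j => hB _)]
      refine Finset.prod_congr rfl fun i _ => ?_
      have := hp 1
      rw [(h.hasIncrements_tiltPath hprob 1).gridBox _ _ hstep1 MeasurableSet.univ fun j => hB _]
      simp
    · rw [Set.indicator_of_notMem h0, zero_mul]
      simp [h0]

/-- Only the values on the natural filtration are used, so the choice made among measures with the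
defining property is immaterial. -/
lemma IsIncrementLaw.expChange (h : IsIncrementLaw ν m)
    (hprob : ∀ t, IsProbabilityMeasure (tiltStep lam m c t)) :
    IsIncrementLaw (expChange lam ν c) (tiltStep lam m c) := by
  have hspec : IsExpChange lam ν c (SkipFree.expChange lam ν c) :=
    Classical.epsilon_spec (h.exists_expChange hprob)
  have heq : ∀ (t : ℝ≥0) (Λ : Set Path), MeasurableSet[pathFiltration t] Λ →
      SkipFree.expChange lam ν c Λ = tiltPath lam ν c t Λ := fun t Λ hΛ => by
    rw [hspec t Λ hΛ, tiltPath, withDensity_apply _ (pathFiltration_le t _ hΛ)]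
  refine ⟨⟨?_⟩, ?_, fun T s δ _ A hA B hB => ?_⟩
  · have := h.isProbabilityMeasure_tiltPath (lam := lam) (c := c) hprob 0
    rw [heq 0 _ MeasurableSet.univ, measure_univ]
  · rw [ae_iff, heq 0]
    · exact ae_iff.1 (h.start_tiltPath 0)
    · exact (measurable_eval_pathFiltration le_rfl (measurableSet_singleton (0 : ℝ))).compl
  · rw [heq (s + δ), heq s A hA, h.tiltPath_inter s δ hA hB]
    exact (pathFiltration_mono (le_add_of_nonneg_right zero_le) _ hA).inter
      (measurableSet_incr (le_add_of_nonneg_right zero_le) le_rfl hB)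

end Exist

/-! ### The scale sequence -/

/-- The solution of `lam {1} w (k + 1) + ∑_{l = 1}^k lam {-l} w (k - l) = lam(ℝ) w k`,
`w 0 = 1`. -/
def scaleSeq (lam : Measure ℝ) : ℕ → ℝ
  | 0 => 1
  | k + 1 => (lam.real Set.univ * scaleSeq lam k -
      ∑ l : Fin k, lam.real {-(((l : ℕ) + 1 : ℕ) : ℝ)} * scaleSeq lam (k - ((l : ℕ) + 1))) /
        lam.real {1}

namespace IsSkipFreeMeasure

variable {lam : Measure ℝ} (h : IsSkipFreeMeasure lam)
include h

lemma real_one_pos : 0 < lam.real {1} := by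
  have := h.finite
  exact ENNReal.toReal_pos h.one (measure_ne_top _ _)

lemma real_univ_pos : 0 < lam.real Set.univ := by
  have := h.finite
  exact h.real_one_pos.trans_le (measureReal_mono (Set.subset_univ _))

lemma scaleSeq_succ (k : ℕ) : lam.real {1} * scaleSeq lam (k + 1) =
    lam.real Set.univ * scaleSeq lam k -
      ∑ l ∈ Finset.Icc 1 k, lam.real {-(l : ℝ)} * scaleSeq lam (k - l) := by
  rw [scaleSeq, mul_div_cancel₀ _ h.real_one_pos.ne', Fin.sum_univ_eq_sum_range
    (fun l => lam.real {-((l + 1 : ℕ) : ℝ)} * scaleSeq lam (k - (l + 1))) k,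
    Finset.range_eq_Ico, Finset.sum_Ico_add'
      (fun l => lam.real {-((l : ℕ) : ℝ)} * scaleSeq lam (k - l)) 0 k 1]
  rfl

lemma one_add_sum_le (k : ℕ) :
    lam.real {1} + ∑ l ∈ Finset.Icc 1 k, lam.real {-(l : ℝ)} ≤ lam.real Set.univ := by
  have := h.finite
  classical
  have hinj : Function.Injective fun l : ℕ => -(l : ℝ) := fun a b hab => by simpa using hab
  have hnot : (1 : ℝ) ∉ (Finset.Icc 1 k).image fun l : ℕ => -(l : ℝ) := by
    intro hmem
    obtain ⟨l, -, hl⟩ := Finset.mem_image.1 hmem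
    have : (0 : ℝ) ≤ l := l.cast_nonneg
    linarith
  rw [← Finset.sum_image (f := fun x => lam.real {x}) fun a _ b _ hab => hinj hab,
    ← Finset.sum_insert (f := fun x => lam.real {x}) hnot, sum_measureReal_singleton]
  exact measureReal_mono (Set.subset_univ _)

/-- If `w` is increasing up to `k`, the recursion gives `λ{1} w(k+1) ≥ (γ - ∑ λ{-l}) w(k) ≥ λ{1}
w(k)`. -/
lemma scaleSeq_mono_pos (k : ℕ) : 0 < scaleSeq lam k ∧ scaleSeq lam k ≤ scaleSeq lam (k + 1) := by
  induction k using Nat.strong_induction_on with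
  | _ k ih =>
    have hle : ∀ j i, j ≤ i → i ≤ k → scaleSeq lam j ≤ scaleSeq lam i := by
      intro j i hji
      induction i, hji using Nat.le_induction with
      | base => exact fun _ => le_rfl
      | succ i _ ihi => exact fun hi => (ihi (by omega)).trans (ih i (by omega)).2
    have hpos : 0 < scaleSeq lam k := by
      have := hle 0 k (Nat.zero_le k) le_rfl
      rw [scaleSeq] at this
      linarith
    refine ⟨hpos, ?_⟩
    refine le_of_mul_le_mul_left ?_ h.real_one_pos
    rw [h.scaleSeq_succ]
    have h1 : ∑ l ∈ Finset.Icc 1 k, lam.real {-(l : ℝ)} * scaleSeq lam (k - l) ≤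
        (∑ l ∈ Finset.Icc 1 k, lam.real {-(l : ℝ)}) * scaleSeq lam k := by
      rw [Finset.sum_mul]
      exact Finset.sum_le_sum fun l _ =>
        mul_le_mul_of_nonneg_left (hle _ _ (Nat.sub_le _ _) le_rfl) measureReal_nonneg
    nlinarith [h.one_add_sum_le k]

lemma scaleSeq_pos (k : ℕ) : 0 < scaleSeq lam k := (h.scaleSeq_mono_pos k).1

lemma scaleSeq_mono : Monotone (scaleSeq lam) :=
  monotone_nat_of_le_succ fun k => (h.scaleSeq_mono_pos k).2

end IsSkipFreeMeasure

/-! ### One step estimate -/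

/-- The scale sequence shifted by `n`, extended by `0` below and frozen above `1`. -/
def cappedScale (lam : Measure ℝ) (n : ℕ) (x : ℝ) : ℝ :=
  if x + n < 0 then 0 else scaleSeq lam (min ⌊x + n⌋₊ (n + 1))

lemma measurable_cappedScale (lam : Measure ℝ) (n : ℕ) : Measurable (cappedScale lam n) := by
  refine Measurable.ite (measurableSet_lt (by fun_prop) measurable_const) measurable_const ?_
  have h1 : Measurable fun x : ℝ => ⌊x + n⌋₊ := Nat.measurable_floor.comp (by fun_prop)
  exact (measurable_from_nat (f := fun k => scaleSeq lam (min k (n + 1)))).comp h1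

lemma cappedScale_int (lam : Measure ℝ) (n k : ℕ) (hk : k ≤ n + 1) {x : ℝ} (hx : x = k - n) :
    cappedScale lam n x = scaleSeq lam k := by
  have : x + n = k := by rw [hx]; ring
  rw [cappedScale, this, if_neg (by simp), Nat.floor_natCast, min_eq_left hk]

lemma cappedScale_of_lt (lam : Measure ℝ) (n : ℕ) {x : ℝ} (hx : x < -n) :
    cappedScale lam n x = 0 := if_pos (by linarith)

lemma cappedScale_of_one_le (lam : Measure ℝ) (n : ℕ) {x : ℝ} (hx : 1 ≤ x) :
    cappedScale lam n x = scaleSeq lam (n + 1) := by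
  have h0 : (0 : ℝ) ≤ n := n.cast_nonneg
  rw [cappedScale, if_neg (by linarith), min_eq_right]
  refine Nat.le_floor ?_
  push_cast; linarith

namespace IsSkipFreeMeasure

variable {lam : Measure ℝ} (h : IsSkipFreeMeasure lam)
include h

lemma cappedScale_nonneg (n : ℕ) (x : ℝ) : 0 ≤ cappedScale lam n x := by
  rw [cappedScale]; split_ifs
  · exact le_rfl
  · exact (h.scaleSeq_pos _).le

lemma cappedScale_le (n : ℕ) (x : ℝ) : cappedScale lam n x ≤ scaleSeq lam (n + 1) := by
  rw [cappedScale]; split_ifs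
  · exact (h.scaleSeq_pos _).le
  · exact h.scaleSeq_mono (min_le_right _ _)

lemma integrable_cappedScale (n : ℕ) (x : ℝ) (μ : Measure ℝ) [IsFiniteMeasure μ] :
    Integrable (fun y => cappedScale lam n (x + y)) μ := by
  refine (integrable_const (scaleSeq lam (n + 1))).mono
    ((measurable_cappedScale lam n).comp (by fun_prop)).aestronglyMeasurable
    (Eventually.of_forall fun y => ?_)
  rw [Real.norm_of_nonneg (h.cappedScale_nonneg _ _), Real.norm_of_nonneg (h.scaleSeq_pos _).le]
  exact h.cappedScale_le _ _

/-- Harmonicity inside the interval. A single jump from a point `≤ 0` reaches at most `1`, so the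
cap is not felt, and jumps below `-n` contribute `0`; what remains is the recursion. -/
lemma integral_cappedScale (n k : ℕ) (hk : k ≤ n) {x : ℝ} (hx : x = k - n) :
    ∫ y, cappedScale lam n (x + y) ∂lam = lam.real Set.univ * cappedScale lam n x := by
  have := h.finite
  have hae : (fun y => cappedScale lam n (x + y)) =ᵐ[lam] fun y =>
      Set.indicator {(1 : ℝ)} (fun _ => scaleSeq lam (k + 1)) y +
        ∑ l ∈ Finset.Icc 1 k, Set.indicator {-(l : ℝ)} (fun _ => scaleSeq lam (k - l)) y := by
    have h0 : ∀ᵐ y ∂lam, y ≠ 0 := by rw [ae_iff]; simpa using h.zero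
    filter_upwards [h.ae_int, h.ae_le_one, h0] with y ⟨z, hz⟩ hy1 hy0
    subst hz
    have hz1 : z ≤ 1 := by exact_mod_cast hy1
    have hz0 : z ≠ 0 := by exact_mod_cast hy0
    rcases eq_or_lt_of_le hz1 with rfl | hz1
    · rw [cappedScale_int lam n (k + 1) (by omega) (by rw [hx]; push_cast; ring),
        Finset.sum_eq_zero, Set.indicator_of_mem (by simp), add_zero]
      intro l _
      refine Set.indicator_of_notMem (fun hl => ?_) _
      have hl' : ((1 : ℤ) : ℝ) = -(l : ℝ) := hl
      have : (0 : ℝ) ≤ l := l.cast_nonneg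
      push_cast at hl'
      linarith
    · obtain ⟨l, rfl⟩ : ∃ l : ℕ, z = -(l : ℤ) := ⟨z.natAbs, by omega⟩
      have hl : 1 ≤ l := by omega
      rw [Set.indicator_of_notMem, zero_add]
      · have hterm : ∀ l' : ℕ, Set.indicator {-(l' : ℝ)} (fun _ => scaleSeq lam (k - l'))
            ((-(l : ℤ) : ℤ) : ℝ) = if l' = l then scaleSeq lam (k - l) else 0 := by
          intro l'
          by_cases hll : l' = l
          · subst hll; simp
          · rw [if_neg hll, Set.indicator_of_notMem]
            simp only [Set.mem_singleton_iff]
            push_cast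
            intro hc
            exact hll (by exact_mod_cast (neg_injective hc).symm)
        simp_rw [hterm]
        rw [Finset.sum_ite_eq']
        by_cases hlk : l ≤ k
        · rw [if_pos (by simp [hl, hlk])]
          refine cappedScale_int lam n (k - l) (by omega) ?_
          rw [hx, Nat.cast_sub hlk]; push_cast; ring
        · rw [if_neg (by simp [hlk])]
          refine cappedScale_of_lt lam n ?_
          have : (k : ℝ) < l := by exact_mod_cast not_le.1 hlk
          rw [hx]; push_cast; linarith
      · simp only [Set.mem_singleton_iff]
        intro hc
        have : (-(l : ℤ) : ℤ) = 1 := by exact_mod_cast hc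
        omega
  have hint : ∀ (a b : ℝ), Integrable (Set.indicator {a} fun _ => b) lam := fun a b =>
    (integrable_const b).indicator (measurableSet_singleton a)
  rw [integral_congr_ae hae, integral_add (hint _ _) (integrable_finsetSum _ fun l _ => hint _ _),
    integral_finsetSum _ fun l _ => hint _ _]
  simp_rw [integral_indicator_const _ (measurableSet_singleton _), smul_eq_mul]
  rw [h.scaleSeq_succ, cappedScale_int lam n k (by omega) hx]
  ring

/-- The part with at most one jump multiplies the function by `e^{-γt}(1 + γt)` by harmonicity. The
remainder has the complementary mass, of order `(γt)²`, and the function is bounded. -/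
lemma abs_integral_step_sub_le {m : ℝ≥0 → Measure ℝ} (hm : IsStepFamily lam m) (n k : ℕ)
    (hk : k ≤ n) {x : ℝ} (hx : x = k - n) (t : ℝ≥0) :
    |(∫ y, cappedScale lam n (x + y) ∂(m t)) - cappedScale lam n x| ≤
      scaleSeq lam (n + 1) * (lam.real Set.univ * t) ^ 2 := by
  have := h.finite
  have hprob := hm.prob t
  set γ := lam.real Set.univ with hγ
  set L : Measure ℝ := ENNReal.ofReal (Real.exp (-(γ * t))) •
    (Measure.dirac 0 + (t : ℝ≥0∞) • lam) with hL
  have hLle : L ≤ m t := hm.lower t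
  have hLfin : IsFiniteMeasure L := isFiniteMeasure_of_le _ hLle
  have hsub : m t - L + L = m t := Measure.sub_add_cancel_of_le hLle
  set R := m t - L with hR
  have hRfin : IsFiniteMeasure R := isFiniteMeasure_of_le (m t) Measure.sub_le
  have hLint : ∀ μ : Measure ℝ, IsFiniteMeasure μ → Integrable (fun y => cappedScale lam n (x + y)) μ :=
    fun μ _ => h.integrable_cappedScale n x μ
  set F := cappedScale lam n x with hF
  have htlam : IsFiniteMeasure ((t : ℝ≥0∞) • lam) := lam.smul_finite ENNReal.coe_ne_top
  have hIL : ∫ y, cappedScale lam n (x + y) ∂L = Real.exp (-(γ * t)) * (1 + γ * t) * F := by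
    rw [hL, integral_smul_measure, integral_add_measure (hLint _ inferInstance)
      (hLint _ htlam), integral_smul_measure, h.integral_cappedScale n k hk hx, integral_dirac,
      ENNReal.toReal_ofReal (Real.exp_pos _).le]
    simp only [add_zero, smul_eq_mul, ENNReal.coe_toReal]
    ring
  have hLuniv : L.real Set.univ = Real.exp (-(γ * t)) * (1 + γ * t) := by
    rw [hL, measureReal_ennreal_smul_apply, measureReal_add_apply, measureReal_ennreal_smul_apply,
      ENNReal.toReal_ofReal (Real.exp_pos _).le]
    simp only [probReal_univ, ENNReal.coe_toReal]
    ring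
  have hRuniv : R.real Set.univ = 1 - Real.exp (-(γ * t)) * (1 + γ * t) := by
    have h1 : (R + L).real Set.univ = 1 := by rw [hsub]; exact probReal_univ
    rw [measureReal_add_apply, hLuniv] at h1
    linarith
  have hsum : ∫ y, cappedScale lam n (x + y) ∂(m t) =
      (∫ y, cappedScale lam n (x + y) ∂(R)) + (∫ y, cappedScale lam n (x + y) ∂L) := by
    rw [← integral_add_measure (hLint _ hRfin) (hLint _ hLfin), hsub]
  have hR0 : 0 ≤ ∫ y, cappedScale lam n (x + y) ∂(R) :=
    integral_nonneg fun y => h.cappedScale_nonneg _ _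
  have hR1 : ∫ y, cappedScale lam n (x + y) ∂(R) ≤ R.real Set.univ * scaleSeq lam (n + 1) := by
    have := integral_mono (hLint R hRfin) (integrable_const (scaleSeq lam (n + 1)))
      fun y => h.cappedScale_le n (x + y)
    simpa using this
  -- From `e^{-a} ≥ 1 - a` one gets `e^{-a}(1 + a) ≥ 1 - a²`.
  have hε : 1 - Real.exp (-(γ * t)) * (1 + γ * t) ≤ (γ * t) ^ 2 := by
    have h1 := Real.add_one_le_exp (-(γ * t))
    have h2 : 0 ≤ γ * t := by positivity
    nlinarith
  have hF0 := h.cappedScale_nonneg n x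
  have hF1 := h.cappedScale_le n x
  have hε0 : 0 ≤ R.real Set.univ := measureReal_nonneg
  rw [hRuniv] at hR1 hε0
  rw [hsum, hIL, abs_le]
  have hw := h.scaleSeq_pos (n + 1)
  constructor <;> nlinarith

end IsSkipFreeMeasure

/-! ### Exit from a finite interval along a grid -/

/-- The path stays in `[-n, 1)` at the first `k + 1` grid times. -/
def stayIn (n : ℕ) (δ : ℝ≥0) (k : ℕ) : Set Path :=
  {w | ∀ j ≤ k, w.1 (j * δ) ∈ Set.Ico (-(n : ℝ)) 1}

/-- Along the grid, the path leaves `[-n, 1)` upwards within `k` steps. -/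
def exitUp (n : ℕ) (δ : ℝ≥0) (k : ℕ) : Set Path :=
  {w | ∃ j ≤ k, 1 ≤ w.1 (j * δ) ∧ ∀ i < j, w.1 (i * δ) ∈ Set.Ico (-(n : ℝ)) 1}

lemma measurableSet_stayIn (n : ℕ) (δ : ℝ≥0) (k : ℕ) :
    MeasurableSet[pathFiltration (k * δ)] (stayIn n δ k) := by
  rw [stayIn, Set.ofPred_forall]
  refine MeasurableSet.iInter fun j => ?_
  rw [Set.ofPred_forall]
  refine MeasurableSet.iInter fun hj => ?_
  refine measurable_eval_pathFiltration ?_ measurableSet_Ico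
  gcongr

lemma stayIn_succ (n : ℕ) (δ : ℝ≥0) (k : ℕ) : stayIn n δ (k + 1) =
    stayIn n δ k ∩ {w | w.1 ((k + 1 : ℕ) * δ) ∈ Set.Ico (-(n : ℝ)) 1} := by
  ext w
  simp only [stayIn, Set.mem_inter_iff, Set.mem_ofPred_eq]
  refine ⟨fun h => ⟨fun j hj => h j (by omega), h _ le_rfl⟩, fun h j hj => ?_⟩
  rcases Nat.le_succ_iff.1 hj with hj | rfl
  · exact h.1 j hj
  · exact h.2

lemma exitUp_succ (n : ℕ) (δ : ℝ≥0) (k : ℕ) : exitUp n δ (k + 1) =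
    exitUp n δ k ∪ (stayIn n δ k ∩ {w | 1 ≤ w.1 ((k + 1 : ℕ) * δ)}) := by
  ext w
  simp only [stayIn, exitUp, Set.mem_inter_iff, Set.mem_union, Set.mem_ofPred_eq]
  constructor
  · rintro ⟨j, hj, h1, h2⟩
    rcases Nat.le_succ_iff.1 hj with hj | rfl
    · exact Or.inl ⟨j, hj, h1, h2⟩
    · exact Or.inr ⟨fun i hi => h2 i (by omega), h1⟩
  · rintro (⟨j, hj, h1, h2⟩ | ⟨h1, h2⟩)
    · exact ⟨j, by omega, h1, h2⟩
    · exact ⟨k + 1, le_rfl, h2, fun i hi => h1 i (by omega)⟩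

lemma disjoint_exitUp (n : ℕ) (δ : ℝ≥0) (k : ℕ) (s : Set Path) :
    Disjoint (exitUp n δ k) (stayIn n δ k ∩ s) := by
  rw [Set.disjoint_left]
  rintro w ⟨j, hj, h1, -⟩ ⟨h2, -⟩
  exact absurd (h2 j hj).2 (not_lt.2 h1)

lemma measurableSet_exitUp (n : ℕ) (δ : ℝ≥0) (k : ℕ) : MeasurableSet (exitUp n δ k) := by
  induction k with
  | zero =>
    have : exitUp n δ 0 = {w | 1 ≤ w.1 0} := by
      ext w; simp [exitUp]
    rw [this]
    exact measurableSet_le measurable_const (measurable_eval 0)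
  | succ k ih =>
    rw [exitUp_succ]
    exact ih.union ((pathFiltration_le _ _ (measurableSet_stayIn n δ k)).inter
      (measurableSet_le measurable_const (measurable_eval _)))

section Exit

variable {ν : Measure Path} {m : ℝ≥0 → Measure ℝ} {lam : Measure ℝ}

lemma IsIncrementLaw.setIntegral_incr (hν : IsIncrementLaw ν m) (s δ : ℝ≥0) {A : Set Path}
    (hA : MeasurableSet[pathFiltration s] A) {g : ℝ → ℝ} (hg : Measurable g) :
    ∫ w in A, g (w.1 (s + δ) - w.1 s) ∂ν = ν.real A * ∫ y, g y ∂(m δ) := by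
  have hincr : Measurable fun w : Path => w.1 (s + δ) - w.1 s :=
    (measurable_eval _).sub (measurable_eval _)
  have hmap : (ν.restrict A).map (fun w : Path => w.1 (s + δ) - w.1 s) = ν A • m δ := by
    ext B hB
    rw [Measure.map_apply hincr hB, Measure.restrict_apply (hincr hB), Measure.smul_apply,
      smul_eq_mul, ← hν.incr (s + δ) s δ le_rfl A hA B hB, Set.inter_comm]
    rfl
  have := integral_map (μ := ν.restrict A) hincr.aemeasurable (f := g)
    hg.aestronglyMeasurable
  rw [← this, hmap, integral_smul_measure, smul_eq_mul, measureReal_def]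

lemma IsIncrementLaw.ae_int (hν : IsIncrementLaw ν m) (hm : IsStepFamily lam m) (s : ℝ≥0) :
    ∀ᵐ w ∂ν, ∃ k : ℤ, (k : ℝ) = w.1 s := by
  have := hν.prob
  have h1 := hν.incr s 0 s (by simp) Set.univ MeasurableSet.univ _ measurableSet_range_intCast.compl
  rw [hm.int, mul_zero, Set.univ_inter] at h1
  have h2 : ∀ᵐ w ∂ν, w.1 (0 + s) - w.1 0 ∈ Set.range ((↑) : ℤ → ℝ) := by rw [ae_iff]; exact h1
  filter_upwards [h2, hν.start] with w hw h0
  rwa [h0, zero_add, sub_zero] at hw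

lemma integrable_cappedScale_eval (h : IsSkipFreeMeasure lam) (ν : Measure Path)
    [IsFiniteMeasure ν] (n : ℕ) (s : ℝ≥0) :
    Integrable (fun w : Path => cappedScale lam n (w.1 s)) ν := by
  refine (integrable_const (scaleSeq lam (n + 1))).mono
    ((measurable_cappedScale lam n).comp (measurable_eval s)).aestronglyMeasurable
    (Eventually.of_forall fun y => ?_)
  rw [Real.norm_of_nonneg (h.cappedScale_nonneg _ _), Real.norm_of_nonneg (h.scaleSeq_pos _).le]
  exact h.cappedScale_le _ _

/-- Conditioning on the `n + 1` possible integer positions reduces this to the one-step estimate at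
a fixed point. -/
lemma IsIncrementLaw.abs_setIntegral_sub_le (hν : IsIncrementLaw ν m) (hm : IsStepFamily lam m)
    (h : IsSkipFreeMeasure lam) (n : ℕ) (s δ : ℝ≥0) {A : Set Path}
    (hA : MeasurableSet[pathFiltration s] A) (hAI : ∀ w ∈ A, w.1 s ∈ Set.Ico (-(n : ℝ)) 1) :
    |(∫ w in A, cappedScale lam n (w.1 (s + δ)) ∂ν) - ∫ w in A, cappedScale lam n (w.1 s) ∂ν| ≤
      scaleSeq lam (n + 1) * (lam.real Set.univ * δ) ^ 2 := by
  have := hν.prob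
  let E : ℕ → Set Path := fun j => A ∩ {w | w.1 s = j - n}
  have hE : ∀ j, MeasurableSet[pathFiltration s] (E j) := fun j =>
    hA.inter (measurable_eval_pathFiltration le_rfl (measurableSet_singleton ((j : ℝ) - n)))
  have hE' : ∀ j, MeasurableSet (E j) := fun j => pathFiltration_le s _ (hE j)
  have hdisj : Pairwise (Function.onFun Disjoint E) := by
    intro i j hij
    rw [Function.onFun, Set.disjoint_left]
    rintro w ⟨-, h1⟩ ⟨-, h2⟩
    rw [Set.mem_ofPred_eq] at h1 h2
    rw [h1] at h2
    exact hij (by exact_mod_cast sub_left_injective h2)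
  have hunion : A =ᵐ[ν] ⋃ j ∈ Finset.range (n + 1), E j := by
    filter_upwards [hν.ae_int hm s] with w ⟨z, hz⟩
    refine propext ⟨fun hw => ?_, fun hw => ?_⟩
    · have hI := hAI w hw
      rw [← hz] at hI
      have h1 : -(n : ℤ) ≤ z := by exact_mod_cast hI.1
      have h2 : z < 1 := by exact_mod_cast hI.2
      refine Set.mem_biUnion (x := (z + n).toNat) (by simp; omega) ⟨hw, ?_⟩
      have h3 : (((z + n).toNat : ℤ) : ℝ) = ((z + n : ℤ) : ℝ) := by
        rw [Int.toNat_of_nonneg (by omega)]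
      rw [Set.mem_ofPred_eq, ← hz]
      push_cast at h3
      rw [h3]; ring
    · obtain ⟨j, -, hj⟩ := Set.mem_iUnion₂.1 hw
      exact hj.1
  have hsplit : ∀ u : ℝ≥0, ∫ w in A, cappedScale lam n (w.1 u) ∂ν =
      ∑ j ∈ Finset.range (n + 1), ∫ w in E j, cappedScale lam n (w.1 u) ∂ν := by
    intro u
    rw [setIntegral_congr_set hunion, integral_biUnion_finset _ (fun j _ => hE' j)
      (hdisj.set_pairwise _) fun j _ => (integrable_cappedScale_eval h ν n u).integrableOn]
  have h1 : ∀ j, ∫ w in E j, cappedScale lam n (w.1 s) ∂ν =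
      ν.real (E j) * cappedScale lam n (j - n) := by
    intro j
    rw [setIntegral_congr_fun (g := fun _ => cappedScale lam n (j - n)) (hE' j)
      fun w hw => by simp only [hw.2.out], setIntegral_const, smul_eq_mul]
  have h2 : ∀ j, ∫ w in E j, cappedScale lam n (w.1 (s + δ)) ∂ν =
      ν.real (E j) * ∫ y, cappedScale lam n ((j - n) + y) ∂(m δ) := by
    intro j
    rw [← hν.setIntegral_incr s δ (hE j) (g := fun y => cappedScale lam n ((j - n) + y))
      ((measurable_cappedScale lam n).comp (by fun_prop))]
    refine setIntegral_congr_fun (hE' j) fun w hw => ?_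
    have : w.1 s = j - n := hw.2
    simp only [this]
    congr 1; ring
  have hmass : ∑ j ∈ Finset.range (n + 1), ν.real (E j) ≤ 1 := by
    rw [← measureReal_biUnion_finset (hdisj.set_pairwise _) fun j _ => hE' j]
    exact measureReal_le_one
  rw [hsplit, hsplit, ← Finset.sum_sub_distrib]
  have hC : 0 ≤ scaleSeq lam (n + 1) * (lam.real Set.univ * δ) ^ 2 :=
    mul_nonneg (h.scaleSeq_pos _).le (sq_nonneg _)
  calc |∑ j ∈ Finset.range (n + 1), ((∫ w in E j, cappedScale lam n (w.1 (s + δ)) ∂ν) -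
        ∫ w in E j, cappedScale lam n (w.1 s) ∂ν)|
      ≤ ∑ j ∈ Finset.range (n + 1), ν.real (E j) *
          (scaleSeq lam (n + 1) * (lam.real Set.univ * δ) ^ 2) := by
        refine (Finset.abs_sum_le_sum_abs _ _).trans (Finset.sum_le_sum fun j hj => ?_)
        rw [h1, h2, ← mul_sub, abs_mul, abs_of_nonneg measureReal_nonneg]
        refine mul_le_mul_of_nonneg_left ?_ measureReal_nonneg
        exact h.abs_integral_step_sub_le hm n j (by simpa [Nat.lt_succ_iff] using hj) rfl δ
    _ ≤ 1 * (scaleSeq lam (n + 1) * (lam.real Set.univ * δ) ^ 2) := by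
        rw [← Finset.sum_mul]
        exact mul_le_mul_of_nonneg_right hmass hC
    _ = _ := one_mul _

/-- The approximate martingale: expected scale function of the path stopped at its exit. -/
def stoppedMean (lam : Measure ℝ) (ν : Measure Path) (n : ℕ) (δ : ℝ≥0) (k : ℕ) : ℝ :=
  scaleSeq lam (n + 1) * ν.real (exitUp n δ k) +
    ∫ w in stayIn n δ k, cappedScale lam n (w.1 (k * δ)) ∂ν

lemma IsIncrementLaw.stoppedMean_zero (hν : IsIncrementLaw ν m) (n : ℕ) (δ : ℝ≥0) :
    stoppedMean lam ν n δ 0 = scaleSeq lam n := by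
  have := hν.prob
  have h1 : ν.real (exitUp n δ 0) = 0 := by
    rw [measureReal_def, measure_mono_null _ (ae_iff.1 hν.start), ENNReal.toReal_zero]
    rintro w ⟨j, hj, hw, -⟩ h0
    obtain rfl : j = 0 := by omega
    rw [Nat.cast_zero, zero_mul, h0] at hw
    linarith
  have h2 : (stayIn n δ 0 : Set Path) =ᵐ[ν] Set.univ := by
    filter_upwards [hν.start] with w hw
    refine propext ⟨fun _ => trivial, fun _ j hj => ?_⟩
    obtain rfl : j = 0 := by omega
    rw [Nat.cast_zero, zero_mul, hw]
    simp
  rw [stoppedMean, h1, setIntegral_congr_set h2, setIntegral_univ,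
    integral_congr_ae (g := fun _ => scaleSeq lam n)]
  · simp
  · filter_upwards [hν.start] with w hw
    rw [Nat.cast_zero, zero_mul, hw]
    exact cappedScale_int lam n n (by omega) (by ring)

/-- Among paths still inside, those now at or above `1` carry the capped value `w(n+1)` and join the
upward exits, while those now below `-n` carry `0`. Hence the change of the stopped mean is the
change of the integral over the paths still inside. -/
lemma IsIncrementLaw.abs_stoppedMean_succ_sub_le (hν : IsIncrementLaw ν m)
    (hm : IsStepFamily lam m) (h : IsSkipFreeMeasure lam) (n : ℕ) (δ : ℝ≥0) (k : ℕ) :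
    |stoppedMean lam ν n δ (k + 1) - stoppedMean lam ν n δ k| ≤
      scaleSeq lam (n + 1) * (lam.real Set.univ * δ) ^ 2 := by
  have := hν.prob
  have hA := pathFiltration_le _ _ (measurableSet_stayIn n δ k)
  have hA1 := pathFiltration_le _ _ (measurableSet_stayIn n δ (k + 1))
  set t : ℝ≥0 := (k + 1 : ℕ) * δ with ht
  have hJ : MeasurableSet {w : Path | 1 ≤ w.1 t} :=
    measurableSet_le measurable_const (measurable_eval _)
  have hU : ν.real (exitUp n δ (k + 1)) =
      ν.real (exitUp n δ k) + ν.real (stayIn n δ k ∩ {w | 1 ≤ w.1 t}) := by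
    rw [exitUp_succ, measureReal_union (disjoint_exitUp n δ k _) (hA.inter hJ)]
  have hint := (integrable_cappedScale_eval h ν n t).integrableOn (s := stayIn n δ k)
  have hsplit := integral_inter_add_sdiff hJ hint
  have hfirst : ∫ w in stayIn n δ k ∩ {w | 1 ≤ w.1 t}, cappedScale lam n (w.1 t) ∂ν =
      scaleSeq lam (n + 1) * ν.real (stayIn n δ k ∩ {w | 1 ≤ w.1 t}) := by
    rw [setIntegral_congr_fun (g := fun _ => scaleSeq lam (n + 1)) (hA.inter hJ)
      fun w hw => cappedScale_of_one_le lam n hw.2, setIntegral_const, smul_eq_mul, mul_comm]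
  have hsecond : ∫ w in stayIn n δ k \ {w | 1 ≤ w.1 t}, cappedScale lam n (w.1 t) ∂ν =
      ∫ w in stayIn n δ (k + 1), cappedScale lam n (w.1 t) ∂ν := by
    refine setIntegral_eq_of_subset_of_forall_sdiff_eq_zero (hA.diff hJ) ?_ ?_
    · rw [stayIn_succ]
      exact fun w hw => ⟨hw.1, not_le.2 hw.2.2⟩
    · rintro w ⟨⟨h1, h2⟩, h3⟩
      rw [stayIn_succ] at h3
      refine cappedScale_of_lt lam n (not_le.1 fun hle => h3 ⟨h1, hle, not_le.1 h2⟩)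
  have hstep := hν.abs_setIntegral_sub_le hm h n (k * δ) δ (measurableSet_stayIn n δ k)
    fun w hw => hw k le_rfl
  rw [show (k : ℝ≥0) * δ + δ = t by rw [ht]; push_cast; ring, ← hsplit, hfirst, hsecond] at hstep
  rw [stoppedMean, stoppedMean, hU]
  convert hstep using 2
  ring

lemma IsIncrementLaw.abs_stoppedMean_sub_le (hν : IsIncrementLaw ν m)
    (hm : IsStepFamily lam m) (h : IsSkipFreeMeasure lam) (n : ℕ) (δ : ℝ≥0) (k : ℕ) :
    |stoppedMean lam ν n δ k - scaleSeq lam n| ≤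
      k * (scaleSeq lam (n + 1) * (lam.real Set.univ * δ) ^ 2) := by
  induction k with
  | zero => simp [hν.stoppedMean_zero]
  | succ k ih =>
    have h1 := hν.abs_stoppedMean_succ_sub_le hm h n δ k
    have h2 := abs_sub_le (stoppedMean lam ν n δ (k + 1)) (stoppedMean lam ν n δ k) (scaleSeq lam n)
    push_cast
    linarith

end Exit

/-! ### Exit in continuous time -/

/-- A right-continuous integer-valued path is constant for a while after each time. -/
lemma Path.eventually_eq (w : Path) (hw : ∀ t, ∃ k : ℤ, (k : ℝ) = w.1 t) (t : ℝ≥0) :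
    ∃ u, t < u ∧ ∀ s ∈ Set.Ico t u, w.1 s = w.1 t := by
  have h1 : ∀ᶠ s in 𝓝[≥] t, dist (w.1 s) (w.1 t) < 1 :=
    (w.2 t).1.tendsto.eventually (Metric.ball_mem_nhds _ one_pos)
  have h2 : ∀ᶠ s in 𝓝[≥] t, w.1 s = w.1 t := by
    filter_upwards [h1] with s hs
    obtain ⟨a, ha⟩ := hw s
    obtain ⟨b, hb⟩ := hw t
    rw [← ha, ← hb, Real.dist_eq] at hs
    rw [← ha, ← hb]
    have : |a - b| < 1 := by exact_mod_cast hs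
    rw [Int.abs_lt_one_iff] at this
    rw [sub_eq_zero.1 this]
  obtain ⟨u, hu, hsub⟩ := (mem_nhdsGE_iff_exists_Ico_subset).1 h2
  exact ⟨u, hu, fun s hs => hsub hs⟩

lemma Path.exists_exit_time (w : Path) (hw : ∀ t, ∃ k : ℤ, (k : ℝ) = w.1 t) {I : Set ℝ}
    (hex : ∃ t, w.1 t ∉ I) : ∃ τ, w.1 τ ∉ I ∧ ∀ s < τ, w.1 s ∈ I := by
  set S : Set ℝ≥0 := {t | w.1 t ∉ I} with hS
  have hne : S.Nonempty := hex
  have hlt : ∀ s < sInf S, w.1 s ∈ I := fun s hs => by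
    by_contra hsI
    exact (csInf_le (OrderBot.bddBelow S) hsI).not_gt hs
  refine ⟨sInf S, fun hI => ?_, hlt⟩
  obtain ⟨u, hu, heq⟩ := w.eventually_eq hw (sInf S)
  obtain ⟨s, hs, hsu⟩ := exists_lt_of_csInf_lt hne hu
  have := heq s ⟨csInf_le (OrderBot.bddBelow S) hs, hsu⟩
  exact hs (by rw [this]; exact hI)

/-- At the exit time the path is either above, with everything before it at least `-n`, or below
`-n` before level `1` has been reached. -/
lemma Path.depth_le_iff (w : Path) (hw : ∀ t, ∃ k : ℤ, (k : ℝ) = w.1 t) (n : ℕ) {τ : ℝ≥0}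
    (hτ : w.1 τ ∉ Set.Ico (-(n : ℝ)) 1) (hlt : ∀ s < τ, w.1 s ∈ Set.Ico (-(n : ℝ)) 1) :
    depth 1 w ≤ ((n : ℝ) : EReal) ↔ 1 ≤ w.1 τ := by
  constructor
  · intro hd
    by_contra h1
    have h2 : w.1 τ < -(n : ℝ) := not_le.1 fun h => hτ ⟨h, not_le.1 h1⟩
    obtain ⟨u, hu, heq⟩ := w.eventually_eq hw τ
    -- Strict inequality is needed, as the depth only sees times before the entrance. It holds
    -- because the path rests at its low value until `u`.
    have h3 : (τ : ℝ≥0∞) < firstEntrance 1 w := by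
      refine lt_of_lt_of_le (ENNReal.coe_lt_coe.2 hu) (le_iInf₂ fun t ht => ?_)
      refine ENNReal.coe_le_coe.2 (not_lt.1 fun htu => ?_)
      rcases lt_or_ge t τ with h | h
      · exact (hlt t h).2.not_ge ht
      · rw [heq t ⟨h, htu⟩] at ht
        exact h1 ht
    have h4 : ((-(w.1 τ) : ℝ) : EReal) ≤ ((n : ℝ) : EReal) :=
      (le_iSup₂ (f := fun (s : ℝ≥0) (_ : (s : ℝ≥0∞) < firstEntrance 1 w) =>
        ((-(w.1 s) : ℝ) : EReal)) τ h3).trans hd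
    rw [EReal.coe_le_coe_iff] at h4
    linarith
  · intro h1
    refine iSup₂_le fun s hs => ?_
    have h2 : s < τ := by
      have : firstEntrance 1 w ≤ τ := iInf₂_le (f := fun (t : ℝ≥0) (_ : 1 ≤ w.1 t) =>
        (t : ℝ≥0∞)) τ h1
      exact ENNReal.coe_lt_coe.1 (hs.trans_le this)
    rw [EReal.coe_le_coe_iff]
    linarith [(hlt s h2).1]

/-- On a fine grid with a long horizon, the first grid time after the exit time falls where the path
is still constant, so the grid sees the same exit side. -/
lemma Path.eventually_grid (w : Path) (hw : ∀ t, ∃ k : ℤ, (k : ℝ) = w.1 t) (n : ℕ)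
    (hex : ∃ t, w.1 t ∉ Set.Ico (-(n : ℝ)) 1) :
    ∀ᶠ N : ℕ in atTop, w ∉ stayIn n (1 / 2 ^ N) (N * 2 ^ N) ∧
      (w ∈ exitUp n (1 / 2 ^ N) (N * 2 ^ N) ↔ depth 1 w ≤ ((n : ℝ) : EReal)) := by
  obtain ⟨τ, hτ, hlt⟩ := w.exists_exit_time hw hex
  obtain ⟨u, hu, heq⟩ := w.eventually_eq hw τ
  rw [w.depth_le_iff hw n hτ hlt]
  have hδ : ∀ N : ℕ, (0 : ℝ≥0) < 1 / 2 ^ N := fun N => by positivity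
  have hlim := tendsto_ceil_mul τ hδ (tendsto_div_two_pow 1)
  filter_upwards [hlim.eventually (gt_mem_nhds hu), eventually_ge_atTop ⌈τ⌉₊] with N hN1 hN2
  set δ : ℝ≥0 := 1 / 2 ^ N with hδdef
  set j := ⌈τ / δ⌉₊ with hj
  have hjle : j ≤ N * 2 ^ N := by
    rw [hj, Nat.ceil_le, div_le_iff₀ (hδ N)]
    push_cast
    rw [mul_assoc, mul_one_div_cancel (by positivity), mul_one]
    exact Nat.ceil_le.1 hN2
  have hjτ : τ ≤ j * δ := le_ceil_mul τ (hδ N)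
  have hwj : w.1 (j * δ) = w.1 τ := heq _ ⟨hjτ, hN1⟩
  have hbefore : ∀ i < j, w.1 (i * δ) ∈ Set.Ico (-(n : ℝ)) 1 := fun i hi => by
    refine hlt _ ?_
    rw [← lt_div_iff₀ (hδ N)]
    exact Nat.lt_ceil.1 hi
  refine ⟨fun h => hτ (hwj ▸ h j hjle), ?_, fun h => ⟨j, hjle, by rwa [hwj], hbefore⟩⟩
  rintro ⟨i, -, h1, h2⟩
  rcases lt_trichotomy i j with hij | rfl | hij
  · exact absurd (hbefore i hij).2 (not_lt.2 h1)
  · rwa [← hwj]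
  · exact absurd (hwj ▸ h2 j hij) hτ

section Exit

variable {ν : Measure Path} {m : ℝ≥0 → Measure ℝ} {lam : Measure ℝ}

/-- Integrality at the countably many dyadic times passes to all times by right-continuity and
closedness of the integers. -/
lemma IsIncrementLaw.ae_forall_int (hν : IsIncrementLaw ν m) (hm : IsStepFamily lam m) :
    ∀ᵐ w ∂ν, ∀ t, ∃ k : ℤ, (k : ℝ) = w.1 t := by
  have h1 : ∀ᵐ w ∂ν, ∀ N k : ℕ, ∃ z : ℤ, (z : ℝ) = w.1 (k * (1 / 2 ^ N)) := by
    rw [ae_all_iff]; intro N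
    rw [ae_all_iff]; intro k
    exact hν.ae_int hm _
  filter_upwards [h1] with w hw t
  have hδ : ∀ N : ℕ, (0 : ℝ≥0) < 1 / 2 ^ N := fun N => by positivity
  have hlim := w.tendsto_of_le (fun N => le_ceil_mul t (hδ N))
    (tendsto_ceil_mul t hδ (tendsto_div_two_pow 1))
  exact Int.isClosedEmbedding_coe_real.isClosed_range.mem_of_tendsto hlim
    (Eventually.of_forall fun N => hw N _)

lemma IsIncrementLaw.real_stayIn_inter (hν : IsIncrementLaw ν m) (n k R : ℕ) :
    ν.real (stayIn n 1 k ∩ {w | ∀ i < R, w.1 ((k + i : ℕ) + 1) - w.1 (k + i : ℕ) ∈ ({1} : Set ℝ)}) =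
      ν.real (stayIn n 1 k) * (m 1).real {1} ^ R := by
  have hmeas : ∀ R : ℕ, MeasurableSet[pathFiltration (k + R : ℕ)] (stayIn n 1 k ∩
      {w | ∀ i < R, w.1 ((k + i : ℕ) + 1) - w.1 (k + i : ℕ) ∈ ({1} : Set ℝ)}) := by
    intro R
    refine MeasurableSet.inter ?_ ?_
    · refine pathFiltration_mono ?_ _ (measurableSet_stayIn n 1 k)
      rw [mul_one]; gcongr; omega
    · rw [Set.ofPred_forall]
      refine MeasurableSet.iInter fun i => ?_
      rw [Set.ofPred_forall]
      refine MeasurableSet.iInter fun hi => ?_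
      refine measurableSet_incr ?_ ?_ (measurableSet_singleton 1)
      · gcongr
      · exact_mod_cast (by omega : k + i + 1 ≤ k + R)
  induction R with
  | zero => simp
  | succ R ih =>
    rw [pow_succ, ← mul_assoc, ← ih, measureReal_def, measureReal_def, measureReal_def,
      ← ENNReal.toReal_mul, ← hν.incr _ _ _ le_rfl _ (hmeas R) _ (measurableSet_singleton 1),
      Set.inter_assoc]
    congr 3
    ext w
    simp only [Set.mem_inter_iff, Set.mem_ofPred_eq, Nat.forall_lt_succ_right]

/-- From a point at least `-n`, a run of `n + 1` unit-time increments all equal to `1` leads out of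
`[-n, 1)`. Such a run has a fixed probability and is independent of the past. -/
lemma IsIncrementLaw.real_stayIn_add_le (hν : IsIncrementLaw ν m) (n k : ℕ) :
    ν.real (stayIn n 1 (k + (n + 1))) ≤
      ν.real (stayIn n 1 k) * (1 - (m 1).real {1} ^ (n + 1)) := by
  have := hν.prob
  set G := stayIn n 1 k ∩
    {w | ∀ i < n + 1, w.1 ((k + i : ℕ) + 1) - w.1 (k + i : ℕ) ∈ ({1} : Set ℝ)} with hG
  have hsub : stayIn n 1 (k + (n + 1)) ∪ G ⊆ stayIn n 1 k :=
    Set.union_subset (fun w hw j hj => hw j (by omega)) Set.inter_subset_left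
  have hdisj : Disjoint (stayIn n 1 (k + (n + 1))) G := by
    rw [Set.disjoint_left]
    rintro w h1 ⟨h2, h3⟩
    have h4 : ∀ i ≤ n + 1, w.1 (k + i : ℕ) = w.1 k + i := by
      intro i hi
      induction i with
      | zero => simp
      | succ i ih =>
        have := h3 i (by omega)
        rw [Set.mem_singleton_iff, ih (by omega)] at this
        rw [← add_assoc, Nat.cast_succ]
        push_cast at this ⊢
        linarith
    have h5 := (h1 (k + (n + 1)) le_rfl).2
    have h6 := (h2 k le_rfl).1
    rw [mul_one] at h5 h6
    rw [h4 _ le_rfl] at h5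
    push_cast at h5
    linarith
  have hle := measureReal_mono (μ := ν) hsub
  rw [measureReal_union' hdisj (pathFiltration_le _ _ (measurableSet_stayIn n 1 _)), hG,
    hν.real_stayIn_inter] at hle
  linarith

lemma IsStepFamily.real_one_pos (hm : IsStepFamily lam m) (h : IsSkipFreeMeasure lam) :
    0 < (m 1).real {1} := by
  have := hm.prob 1
  refine ENNReal.toReal_pos (fun h0 => ?_) (measure_ne_top _ _)
  have h1 := hm.lower 1 {1}
  rw [h0, nonpos_iff_eq_zero] at h1
  simp only [Measure.smul_apply, Measure.add_apply, smul_eq_mul, mul_eq_zero, add_eq_zero] at h1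
  rcases h1 with h1 | h1
  · exact absurd h1 (by simp [Real.exp_pos])
  · exact h.one (by simpa using h1.2)

lemma IsIncrementLaw.ae_exists_exit (hν : IsIncrementLaw ν m) (hm : IsStepFamily lam m)
    (h : IsSkipFreeMeasure lam) (n : ℕ) :
    ∀ᵐ w ∂ν, ∃ t, w.1 t ∉ Set.Ico (-(n : ℝ)) 1 := by
  have := hν.prob
  have := hm.prob 1
  set b := (m 1).real {1} ^ (n + 1) with hb
  have hb0 : 0 < b := pow_pos (hm.real_one_pos h) _
  have hb1 : b ≤ 1 := pow_le_one₀ measureReal_nonneg measureReal_le_one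
  have hle : ∀ k : ℕ, ν.real (stayIn n 1 (k * (n + 1))) ≤ (1 - b) ^ k := by
    intro k
    induction k with
    | zero => simp
    | succ k ih =>
      rw [Nat.succ_mul, pow_succ]
      exact (hν.real_stayIn_add_le n _).trans
        (mul_le_mul_of_nonneg_right ih (by linarith))
  have hzero : ν.real {w : Path | ¬ ∃ t, w.1 t ∉ Set.Ico (-(n : ℝ)) 1} ≤ 0 := by
    refine ge_of_tendsto (tendsto_pow_atTop_nhds_zero_of_lt_one (by linarith : 0 ≤ 1 - b)
      (by linarith)) (Eventually.of_forall fun k => (measureReal_mono ?_).trans (hle k))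
    intro w hw j _
    by_contra hj
    exact hw ⟨_, hj⟩
  rw [ae_iff]
  exact (measureReal_eq_zero_iff (measure_ne_top _ _)).1 (le_antisymm hzero measureReal_nonneg)

/-- The probability that the depth of the path before reaching level `1` is at most `n`. -/
theorem IsIncrementLaw.real_depth_le (hν : IsIncrementLaw ν m) (hm : IsStepFamily lam m)
    (h : IsSkipFreeMeasure lam) (n : ℕ) :
    ν.real {w | depth 1 w ≤ ((n : ℝ) : EReal)} = scaleSeq lam n / scaleSeq lam (n + 1) := by
  have := hν.prob
  have hgood : ∀ᵐ w ∂ν, ∀ᶠ N : ℕ in atTop, w ∉ stayIn n (1 / 2 ^ N) (N * 2 ^ N) ∧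
      (w ∈ exitUp n (1 / 2 ^ N) (N * 2 ^ N) ↔ depth 1 w ≤ ((n : ℝ) : EReal)) := by
    filter_upwards [hν.ae_forall_int hm, hν.ae_exists_exit hm h n] with w h1 h2
    exact w.eventually_grid h1 n h2
  set E : Set Path := {w | depth 1 w ≤ ((n : ℝ) : EReal)} with hE
  -- A measurable version of the event: `E` is defined through an uncountable supremum, whereas `E'`
  -- is a countable combination of grid events.
  set E' : Set Path := {w | ∀ᶠ N : ℕ in atTop, w ∈ exitUp n (1 / 2 ^ N) (N * 2 ^ N)} with hE'
  have hE'm : MeasurableSet E' := by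
    simp only [hE', eventually_atTop, Set.ofPred_exists, Set.ofPred_forall]
    exact MeasurableSet.iUnion fun a => MeasurableSet.iInter fun N => MeasurableSet.iInter fun _ =>
      measurableSet_exitUp n _ _
  have hEE' : E =ᵐ[ν] E' := by
    filter_upwards [hgood] with w hw
    refine propext ⟨fun hwE => hw.mono fun N hN => hN.2.2 hwE, fun hwE => ?_⟩
    obtain ⟨N, hN1, hN2⟩ := (hw.and hwE).exists
    exact hN1.2.1 hN2
  have hAm : ∀ N : ℕ, MeasurableSet (stayIn n (1 / 2 ^ N) (N * 2 ^ N)) := fun N =>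
    pathFiltration_le _ _ (measurableSet_stayIn n _ _)
  have hU : Tendsto (fun N : ℕ => ν.real (exitUp n (1 / 2 ^ N) (N * 2 ^ N))) atTop
      (𝓝 (ν.real E)) := by
    rw [measureReal_congr hEE']
    refine (ENNReal.tendsto_toReal (measure_ne_top _ _)).comp
      (tendsto_measure_of_ae_tendsto_indicator_of_isFiniteMeasure atTop hE'm
        (fun N => measurableSet_exitUp n _ _) ?_)
    filter_upwards [hgood, hEE'] with w hw hwE
    have hwE' : w ∈ E ↔ w ∈ E' := iff_of_eq hwE
    exact hw.mono fun N hN => hN.2.trans hwE'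
  have hA : Tendsto (fun N : ℕ => ν.real (stayIn n (1 / 2 ^ N) (N * 2 ^ N))) atTop (𝓝 0) := by
    have := (ENNReal.tendsto_toReal (measure_ne_top ν ∅)).comp
      (tendsto_measure_of_ae_tendsto_indicator_of_isFiniteMeasure (μ := ν) atTop
        MeasurableSet.empty hAm (by
          filter_upwards [hgood] with w hw
          exact hw.mono fun N hN => by simpa using hN.1))
    rw [measure_empty, ENNReal.toReal_zero] at this
    exact this
  have hw0 := h.scaleSeq_pos (n + 1)
  have hint : Tendsto (fun N : ℕ => ∫ w in stayIn n (1 / 2 ^ N) (N * 2 ^ N),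
      cappedScale lam n (w.1 ((N * 2 ^ N : ℕ) * (1 / 2 ^ N))) ∂ν) atTop (𝓝 0) := by
    refine squeeze_zero (fun N => integral_nonneg fun w => h.cappedScale_nonneg _ _)
      (g := fun N : ℕ => ν.real (stayIn n (1 / 2 ^ N) (N * 2 ^ N)) * scaleSeq lam (n + 1))
      (fun N => ?_) (by simpa using hA.mul_const (scaleSeq lam (n + 1)))
    have := setIntegral_mono (μ := ν) (s := stayIn n (1 / 2 ^ N) (N * 2 ^ N))
      (integrable_cappedScale_eval h ν n ((N * 2 ^ N : ℕ) * (1 / 2 ^ N))).integrableOn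
      (integrable_const (scaleSeq lam (n + 1))).integrableOn fun w => h.cappedScale_le n _
    rwa [setIntegral_const, smul_eq_mul] at this
  have hv1 : Tendsto (fun N : ℕ => stoppedMean lam ν n (1 / 2 ^ N) (N * 2 ^ N)) atTop
      (𝓝 (scaleSeq lam (n + 1) * ν.real E)) := by
    simpa [stoppedMean] using (hU.const_mul (scaleSeq lam (n + 1))).add hint
  have hv2 : Tendsto (fun N : ℕ => stoppedMean lam ν n (1 / 2 ^ N) (N * 2 ^ N)) atTop
      (𝓝 (scaleSeq lam n)) := by
    rw [tendsto_iff_dist_tendsto_zero]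
    -- There are `N 2^N` steps, each with error of order `4^{-N}`, so the total is of order `N
    -- 2^{-N}`.
    have hlim : Tendsto (fun N : ℕ => scaleSeq lam (n + 1) * (lam.real Set.univ) ^ 2 *
        (N * (1 / 2 : ℝ) ^ N)) atTop (𝓝 0) := by
      have := (tendsto_self_mul_const_pow_of_lt_one (r := (1 / 2 : ℝ)) (by norm_num)
        (by norm_num)).const_mul (scaleSeq lam (n + 1) * (lam.real Set.univ) ^ 2)
      simpa using this
    refine squeeze_zero (fun N => dist_nonneg) (fun N => ?_) hlim
    rw [Real.dist_eq]
    refine (hν.abs_stoppedMean_sub_le hm h n _ _).trans (le_of_eq ?_)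
    push_cast
    rw [one_div_pow]
    field_simp
  rw [eq_div_iff hw0.ne', mul_comm]
  exact tendsto_nhds_unique hv1 hv2

end Exit

/-! ### Laplace exponents and generating functions -/

namespace IsSkipFreeMeasure

variable {lam : Measure ℝ} (h : IsSkipFreeMeasure lam)
include h

/-- The points `1 - l` with `l ≥ 0` exhaust the integers up to `1`, which carry the measure. -/
lemma hasSum_integral {g : ℝ → ℝ} (hg : Integrable g lam) :
    HasSum (fun l : ℕ => lam.real {1 - (l : ℝ)} * g (1 - l)) (∫ x, g x ∂lam) := by
  have := h.finite
  have h1 := hasSum_integral_iUnion (μ := lam) (f := g) (s := fun l : ℕ => {1 - (l : ℝ)})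
    (fun l => measurableSet_singleton _) (fun i j hij => by
      simpa using fun hc : i = j => hij hc) hg.integrableOn
  have h2 : (⋃ l : ℕ, {1 - (l : ℝ)}) =ᵐ[lam] Set.univ := by
    filter_upwards [h.ae_int, h.ae_le_one] with x ⟨z, hz⟩ hx
    refine propext ⟨fun _ => trivial, fun _ => ?_⟩
    subst hz
    have hz : z ≤ 1 := by exact_mod_cast hx
    refine Set.mem_iUnion.2 ⟨(1 - z).toNat, ?_⟩
    have h3 : (((1 - z).toNat : ℤ) : ℝ) = ((1 - z : ℤ) : ℝ) := by
      rw [Int.toNat_of_nonneg (by omega)]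
    push_cast at h3
    rw [Set.mem_singleton_iff, h3]; ring
  rw [setIntegral_congr_set h2, setIntegral_univ] at h1
  simpa only [integral_singleton, smul_eq_mul] using h1

lemma hasSum_exp {β : ℝ} (hβ : 0 ≤ β) :
    HasSum (fun l : ℕ => lam.real {1 - (l : ℝ)} * (Real.exp β * Real.exp (-β) ^ l))
      (laplaceExponent lam β + lam.real Set.univ) := by
  have := h.hasSum_integral (h.integrable_exp hβ)
  rw [h.integral_exp hβ] at this
  convert this using 3 with l
  rw [← Real.exp_nat_mul, ← Real.exp_add]
  congr 1; ring

lemma summable_atoms : Summable fun l : ℕ => lam.real {1 - (l : ℝ)} := by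
  have := h.finite
  simpa using (h.hasSum_integral (integrable_const (1 : ℝ))).summable

/-- Keeping only the atom at `1` gives a lower bound growing in `β`. It bounds the zeros of `ψ` and
makes `ψ` exceed any given value. -/
lemma le_laplaceExponent {β : ℝ} (hβ : 0 ≤ β) :
    lam.real {1} * β ≤ laplaceExponent lam β + lam.real Set.univ := by
  have h1 := le_hasSum (h.hasSum_exp hβ) 0 fun l _ => mul_nonneg measureReal_nonneg (by positivity)
  simp only [Nat.cast_zero, sub_zero, pow_zero, mul_one] at h1
  have h2 : β ≤ Real.exp β := by linarith [Real.add_one_le_exp β]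
  exact (mul_le_mul_of_nonneg_left h2 measureReal_nonneg).trans h1

lemma bddAbove_zeros : BddAbove {β : ℝ | 0 ≤ β ∧ laplaceExponent lam β = 0} := by
  refine ⟨lam.real Set.univ / lam.real {1}, fun β hβ => ?_⟩
  have := h.le_laplaceExponent hβ.1
  rw [hβ.2, zero_add] at this
  rw [le_div_iff₀ h.real_one_pos]
  linarith

omit h in
lemma _root_.SkipFree.laplaceExponent_zero (lam : Measure ℝ) : laplaceExponent lam 0 = 0 := by
  simp [laplaceExponent]

lemma largestZero_nonneg : 0 ≤ largestZero lam :=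
  le_csSup h.bddAbove_zeros ⟨le_rfl, laplaceExponent_zero lam⟩

lemma laplaceExponent_ne_zero {β : ℝ} (hβ : largestZero lam < β) : laplaceExponent lam β ≠ 0 :=
  fun h0 => (le_csSup h.bddAbove_zeros ⟨h.largestZero_nonneg.trans hβ.le, h0⟩).not_gt hβ

lemma continuousOn_laplaceExponent (B : ℝ) :
    ContinuousOn (laplaceExponent lam) (Set.Icc 0 B) := by
  have := h.finite
  unfold laplaceExponent
  refine continuousOn_of_dominated (bound := fun _ => Real.exp |B| + 1)
    (fun β _ => by fun_prop) (fun β hβ => ?_) (integrable_const _)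
    (Eventually.of_forall fun x => by fun_prop)
  filter_upwards [h.ae_le_one] with x hx
  refine (norm_sub_le _ _).trans ?_
  rw [Real.norm_of_nonneg (Real.exp_pos _).le, norm_one]
  have : β * x ≤ |B| := by nlinarith [hβ.1, hβ.2, le_abs_self B]
  linarith [Real.exp_le_exp.2 this]

lemma laplaceExponent_largestZero : laplaceExponent lam (largestZero lam) = 0 := by
  obtain ⟨B, hB⟩ := h.bddAbove_zeros
  set S := {β : ℝ | 0 ≤ β ∧ laplaceExponent lam β = 0} with hS
  have hclosed : IsClosed S := by
    have : S = Set.Icc 0 B ∩ laplaceExponent lam ⁻¹' {0} := by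
      ext β
      refine ⟨fun hβ => ⟨⟨hβ.1, hB hβ⟩, hβ.2⟩, fun hβ => ⟨hβ.1.1, hβ.2⟩⟩
    rw [this]
    exact (h.continuousOn_laplaceExponent B).preimage_isClosed_of_isClosed isClosed_Icc
      isClosed_singleton
  exact (hclosed.csSup_mem ⟨0, le_rfl, laplaceExponent_zero lam⟩ ⟨B, hB⟩).2

lemma invLaplaceExponent_spec {q : ℝ} (hq : 0 ≤ q) :
    0 ≤ invLaplaceExponent lam q ∧ laplaceExponent lam (invLaplaceExponent lam q) = q := by
  -- The second entry forces `ψ(B) ≥ q` by the linear lower bound, so the intermediate value theorem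
  -- applies between `Φ(0)` and `B`.
  set B := max (largestZero lam) ((q + lam.real Set.univ) / lam.real {1}) with hB
  have h0 := h.largestZero_nonneg
  have hBle : largestZero lam ≤ B := le_max_left _ _
  have hqB : q ≤ laplaceExponent lam B := by
    have h1 := h.le_laplaceExponent (h0.trans hBle)
    have h2 : (q + lam.real Set.univ) / lam.real {1} ≤ B := le_max_right _ _
    rw [div_le_iff₀ h.real_one_pos] at h2
    linarith
  have hivt := intermediate_value_Icc hBle
    ((h.continuousOn_laplaceExponent B).mono (Set.Icc_subset_Icc_left h0))
  obtain ⟨c, hc, hcq⟩ := hivt ⟨by rw [h.laplaceExponent_largestZero]; exact hq, hqB⟩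
  have hex : ∃ a ∈ Set.Ici (largestZero lam), laplaceExponent lam a = q := ⟨c, hc.1, hcq⟩
  exact ⟨h0.trans (Function.invFunOn_mem hex), Function.invFunOn_eq hex⟩

/-- The recursion as a convolution over all atoms `1 - i`. The term `i = 1` is the null atom at `0`.
-/
lemma sum_range_atoms_mul_scaleSeq (k : ℕ) :
    ∑ i ∈ Finset.range (k + 2), lam.real {1 - (i : ℝ)} * scaleSeq lam (k + 1 - i) =
      lam.real Set.univ * scaleSeq lam k := by
  have hz : lam.real {(0 : ℝ)} = 0 := by rw [measureReal_def, h.zero, ENNReal.toReal_zero]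
  have h1 := h.scaleSeq_succ k
  have h2 : ∑ l ∈ Finset.Icc 1 k, lam.real {-(l : ℝ)} * scaleSeq lam (k - l) =
      ∑ l ∈ Finset.range k, lam.real {-((l + 1 : ℕ) : ℝ)} * scaleSeq lam (k - (l + 1)) := by
    rw [Finset.range_eq_Ico, Finset.sum_Ico_add'
      (fun l => lam.real {-((l : ℕ) : ℝ)} * scaleSeq lam (k - l)) 0 k 1]
    rfl
  rw [Finset.sum_range_succ', Finset.sum_range_succ']
  have h3 : ∀ i : ℕ, lam.real {1 - ((i + 1 + 1 : ℕ) : ℝ)} * scaleSeq lam (k + 1 - (i + 1 + 1)) =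
      lam.real {-((i + 1 : ℕ) : ℝ)} * scaleSeq lam (k - (i + 1)) := by
    intro i
    rw [show k + 1 - (i + 1 + 1) = k - (i + 1) by omega]
    congr 3
    push_cast; ring
  simp_rw [h3]
  rw [← h2]
  simp [hz]
  linarith

/-- If `scaleSeq n / scaleSeq (n + 1)` is monotone, the ratio of successive terms of the scale
sequence converges to the exponential of a zero of the Laplace exponent. -/
lemma tendsto_scaleSeq_ratio
    (hmono : Monotone fun n => scaleSeq lam n / scaleSeq lam (n + 1)) :
    ∃ α, 0 ≤ α ∧ laplaceExponent lam α = 0 ∧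
      Tendsto (fun n => scaleSeq lam (n + 1) / scaleSeq lam n) atTop (𝓝 (Real.exp α)) := by
  have hpos := h.scaleSeq_pos
  set a : ℕ → ℝ := fun n => scaleSeq lam n / scaleSeq lam (n + 1) with ha
  have ha1 : ∀ n, a n ≤ 1 := fun n =>
    (div_le_one (hpos _)).2 (h.scaleSeq_mono (Nat.le_succ n))
  have ha0 : ∀ n, 0 < a n := fun n => div_pos (hpos _) (hpos _)
  obtain ⟨s, hs⟩ : ∃ s, Tendsto a atTop (𝓝 s) :=
    ⟨_, tendsto_atTop_ciSup hmono ⟨1, by rintro _ ⟨n, rfl⟩; exact ha1 n⟩⟩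
  have hs1 : s ≤ 1 := le_of_tendsto' hs ha1
  have hs0 : 0 < s := (ha0 0).trans_le (ge_of_tendsto' hs fun n => hmono (Nat.zero_le n))
  have hinv : Tendsto (fun n => scaleSeq lam (n + 1) / scaleSeq lam n) atTop (𝓝 s⁻¹) := by
    have := hs.inv₀ hs0.ne'
    simpa only [ha, inv_div] using this
  -- The limit `s` of `w(n) / w(n+1)` lies in `(0, 1]`, so `e^{-α} = s` has a solution `α ≥ 0`.
  refine ⟨-Real.log s, ?_, ?_, ?_⟩
  · linarith [Real.log_nonpos hs0.le hs1]
  swap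
  · rwa [Real.exp_neg, Real.exp_log hs0]
  have hshift : ∀ i : ℕ, Tendsto (fun n => scaleSeq lam n / scaleSeq lam (n + i)) atTop
      (𝓝 (s ^ i)) := by
    intro i
    induction i with
    | zero => simp [div_self (hpos _).ne']
    | succ i ih =>
      have h2 := ih.mul ((tendsto_add_atTop_iff_nat i).2 hs)
      rw [pow_succ]
      refine h2.congr fun n => ?_
      simp only [ha]
      rw [div_mul_div_cancel₀ (hpos _).ne', add_assoc]
  have hterm : ∀ i : ℕ, Tendsto (fun n => if i < n + 2 then
      lam.real {1 - (i : ℝ)} * (scaleSeq lam (n + 1 - i) / scaleSeq lam n) else 0) atTop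
      (𝓝 (lam.real {1 - (i : ℝ)} * (s⁻¹ * s ^ i))) := by
    intro i
    have h2 : Tendsto (fun n => scaleSeq lam (n + 1 - i) / scaleSeq lam (n + 1)) atTop
        (𝓝 (s ^ i)) := by
      refine (tendsto_add_atTop_iff_nat i).1 (((tendsto_add_atTop_iff_nat 1).2 (hshift i)).congr
        fun n => ?_)
      rw [show n + i + 1 - i = n + 1 by omega, show n + 1 + i = n + i + 1 by omega]
    refine ((hinv.mul h2).const_mul (lam.real {1 - (i : ℝ)})).congr' ?_
    filter_upwards [eventually_ge_atTop i] with n hn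
    rw [if_pos (by omega), mul_comm (scaleSeq lam (n + 1) / scaleSeq lam n),
      div_mul_div_cancel₀ (hpos _).ne']
  -- Monotonicity of the ratios bounds `w(n+1) / w(n)` by its value at `n = 0`, which gives a
  -- summable majorant.
  have hbound : ∀ n i : ℕ, ‖(if i < n + 2 then
      lam.real {1 - (i : ℝ)} * (scaleSeq lam (n + 1 - i) / scaleSeq lam n) else 0)‖ ≤
      lam.real {1 - (i : ℝ)} * (a 0)⁻¹ := by
    intro n i
    have h0 : (0 : ℝ) ≤ lam.real {1 - (i : ℝ)} := measureReal_nonneg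
    split_ifs
    · rw [Real.norm_of_nonneg (mul_nonneg h0 (div_pos (hpos _) (hpos _)).le)]
      refine mul_le_mul_of_nonneg_left ?_ h0
      calc scaleSeq lam (n + 1 - i) / scaleSeq lam n
          ≤ scaleSeq lam (n + 1) / scaleSeq lam n :=
            div_le_div_of_nonneg_right (h.scaleSeq_mono (Nat.sub_le _ _)) (hpos _).le
        _ = (a n)⁻¹ := by rw [ha, inv_div]
        _ ≤ (a 0)⁻¹ := inv_anti₀ (ha0 0) (hmono (Nat.zero_le n))
    · rw [norm_zero]
      exact mul_nonneg h0 (inv_nonneg.2 (ha0 0).le)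
  -- Passing to the limit in the recursion divided by `w(n)` gives `∑ λ{1-i} s^{i-1} = γ`, which
  -- says `ψ(-log s) = 0`.
  have hlim := tendsto_tsum_of_dominated_convergence
    (h.summable_atoms.mul_right (a 0)⁻¹) hterm (Eventually.of_forall hbound)
  have hconst : ∀ n : ℕ, ∑' i : ℕ, (if i < n + 2 then
      lam.real {1 - (i : ℝ)} * (scaleSeq lam (n + 1 - i) / scaleSeq lam n) else 0) =
      lam.real Set.univ := by
    intro n
    rw [tsum_eq_sum (s := Finset.range (n + 2)) fun i hi => if_neg (by simpa using hi),
      Finset.sum_congr rfl fun i hi => if_pos (Finset.mem_range.1 hi)]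
    simp_rw [← mul_div_assoc]
    rw [← Finset.sum_div, h.sum_range_atoms_mul_scaleSeq, mul_div_cancel_right₀ _ (hpos n).ne']
  simp_rw [hconst] at hlim
  have hα : 0 ≤ -Real.log s := by linarith [Real.log_nonpos hs0.le hs1]
  have h3 := (h.hasSum_exp hα).tsum_eq
  rw [neg_neg, Real.exp_neg, Real.exp_log hs0] at h3
  have h4 := tendsto_nhds_unique hlim tendsto_const_nhds
  linarith

/-- Ratio test: successive terms have limiting ratio `e^{α - β}` with `α` a zero of `ψ`, hence `α ≤
Φ(0) < β`. -/
lemma summable_scaleSeq (hmono : Monotone fun n => scaleSeq lam n / scaleSeq lam (n + 1))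
    {β : ℝ} (hβ : largestZero lam < β) :
    Summable fun n => scaleSeq lam n * Real.exp (-β) ^ n := by
  obtain ⟨α, hα0, hα, hlim⟩ := h.tendsto_scaleSeq_ratio hmono
  have hαβ : α < β := (le_csSup h.bddAbove_zeros ⟨hα0, hα⟩).trans_lt hβ
  have hpos := h.scaleSeq_pos
  refine summable_of_ratio_test_tendsto_lt_one (l := Real.exp α * Real.exp (-β)) ?_
    (Eventually.of_forall fun n => (mul_pos (hpos n) (pow_pos (Real.exp_pos _) n)).ne') ?_
  · rw [← Real.exp_add, Real.exp_lt_one_iff]; linarith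
  · refine (hlim.mul_const (Real.exp (-β))).congr fun n => ?_
    have he := Real.exp_pos (-β)
    rw [Real.norm_of_nonneg (mul_pos (hpos _) (pow_pos he _)).le,
      Real.norm_of_nonneg (mul_pos (hpos _) (pow_pos he _)).le, pow_succ]
    have := (hpos n).ne'
    field_simp

/-- The generating function of the scale sequence. -/
lemma hasSum_scaleSeq (hmono : Monotone fun n => scaleSeq lam n / scaleSeq lam (n + 1))
    {β : ℝ} (hβ : largestZero lam < β) :
    HasSum (fun n => scaleSeq lam n * Real.exp (-β) ^ n)
      (lam.real {1} * Real.exp β / laplaceExponent lam β) := by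
  have hβ0 : 0 ≤ β := h.largestZero_nonneg.trans hβ.le
  have hψ := h.laplaceExponent_ne_zero hβ
  have hpos := h.scaleSeq_pos
  have hsum := h.summable_scaleSeq hmono hβ
  set z := Real.exp (-β) with hz
  have hz0 : 0 < z := Real.exp_pos _
  have hez : Real.exp β * z = 1 := by rw [hz, ← Real.exp_add]; simp
  set f : ℕ → ℝ := fun l => lam.real {1 - (l : ℝ)} * (Real.exp β * z ^ l) with hf
  have hfsum : HasSum f (laplaceExponent lam β + lam.real Set.univ) := h.hasSum_exp hβ0
  have hfnn : ∀ l, 0 ≤ f l := fun l => mul_nonneg measureReal_nonneg (by positivity)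
  set S := ∑' n, scaleSeq lam n * z ^ n with hS
  -- Cauchy product of the generating functions of `lam` and `w`. By the recursion its term of index
  -- `n + 1` is `γ w(n) z^n`, and its term of index `0` is `λ{1} e^β`. Hence `(ψ(β) + γ) S - λ{1}
  -- e^β = γ S`.
  have hprod := hasSum_sum_range_mul_of_summable_norm (f := f)
    (g := fun n => scaleSeq lam n * z ^ n) (by simpa only [Real.norm_of_nonneg (hfnn _)]
      using hfsum.summable) (by
      simpa only [Real.norm_of_nonneg (mul_pos (hpos _) (pow_pos hz0 _)).le] using hsum)
  rw [hfsum.tsum_eq, ← hS] at hprod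
  have hterm : ∀ n : ℕ, ∑ k ∈ Finset.range (n + 1 + 1), f k * (scaleSeq lam (n + 1 - k) *
      z ^ (n + 1 - k)) = lam.real Set.univ * (scaleSeq lam n * z ^ n) := by
    intro n
    have h1 : ∀ k ∈ Finset.range (n + 1 + 1), f k * (scaleSeq lam (n + 1 - k) *
        z ^ (n + 1 - k)) = (lam.real {1 - (k : ℝ)} * scaleSeq lam (n + 1 - k)) * z ^ n := by
      intro k hk
      have hk' : k ≤ n + 1 := Nat.lt_succ_iff.1 (Finset.mem_range.1 hk)
      have h2 : z ^ k * z ^ (n + 1 - k) = z ^ n * z := by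
        rw [← pow_add, Nat.add_sub_cancel' hk', pow_succ]
      calc f k * (scaleSeq lam (n + 1 - k) * z ^ (n + 1 - k))
          = (lam.real {1 - (k : ℝ)} * scaleSeq lam (n + 1 - k)) *
            (Real.exp β * (z ^ k * z ^ (n + 1 - k))) := by simp only [hf]; ring
        _ = (lam.real {1 - (k : ℝ)} * scaleSeq lam (n + 1 - k)) *
            ((Real.exp β * z) * z ^ n) := by rw [h2]; ring
        _ = _ := by rw [hez, one_mul]
    rw [Finset.sum_congr rfl h1, ← Finset.sum_mul, h.sum_range_atoms_mul_scaleSeq, mul_assoc]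
  have h2 := (hasSum_nat_add_iff' 1).2 hprod
  simp only [hterm] at h2
  have h3 := h2.unique (hsum.hasSum.mul_left (lam.real Set.univ))
  have h4 : scaleSeq lam 0 = 1 := by rw [scaleSeq]
  simp only [Finset.sum_range_one, hf, zero_add, Nat.sub_self, pow_zero, Nat.cast_zero, sub_zero,
    h4, mul_one, ← hS] at h3
  have h5 : S = lam.real {1} * Real.exp β / laplaceExponent lam β := by
    rw [eq_div_iff hψ]; linarith
  rw [← h5]
  exact hsum.hasSum

end IsSkipFreeMeasure

/-! ### Identification of the scale functions -/

section Identify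

variable {ν : Measure Path} {m : ℝ≥0 → Measure ℝ} {lam : Measure ℝ}

/-- The ratios are the probabilities of the increasing events `D₁ ≤ n`; this is the probabilistic
input to the generating function. -/
lemma IsIncrementLaw.monotone_scaleSeq_ratio (hν : IsIncrementLaw ν m) (hm : IsStepFamily lam m)
    (h : IsSkipFreeMeasure lam) :
    Monotone fun n => scaleSeq lam n / scaleSeq lam (n + 1) := by
  have := hν.prob
  intro a b hab
  simp only [← hν.real_depth_le hm h]
  refine measureReal_mono fun w (hw : depth 1 w ≤ _) => hw.trans ?_
  rw [EReal.coe_le_coe_iff]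
  exact_mod_cast hab

/-- The factors `w(r-1) / w(r)` telescope. -/
lemma IsIncrementLaw.rawScale_eq (hν : IsIncrementLaw ν m) (hm : IsStepFamily lam m)
    (h : IsSkipFreeMeasure lam) (x : ℝ) : rawScale 1 ν x = scaleSeq lam ⌊x⌋₊ := by
  have hprod : ∀ N : ℕ, ∏ r ∈ Finset.Icc 1 N,
      ν.real {w | depth 1 w ≤ ((((r : ℝ) - 1) * 1 : ℝ) : EReal)} = 1 / scaleSeq lam N := by
    intro N
    induction N with
    | zero => simp [scaleSeq]
    | succ N ih =>
      rw [Finset.prod_Icc_succ_top (by omega), ih,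
        show (((N + 1 : ℕ) : ℝ) - 1) * 1 = N by push_cast; ring, hν.real_depth_le hm h,
        one_div_mul_eq_div, div_right_comm, div_self (h.scaleSeq_pos N).ne']
  rw [rawScale, hprod, div_one, one_div_one_div]

lemma integral_Ico_exp {β : ℝ} (hβ : β ≠ 0) (n : ℕ) :
    ∫ x in Set.Ico (n : ℝ) (n + 1), Real.exp (-β * x) =
      Real.exp (-β) ^ n * ((1 - Real.exp (-β)) / β) := by
  rw [integral_Ico_eq_integral_Ioc, ← intervalIntegral.integral_of_le (by linarith),
    intervalIntegral.integral_comp_mul_left _ (neg_ne_zero.2 hβ), integral_exp, mul_add, mul_one,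
    Real.exp_add, ← Real.exp_nat_mul, smul_eq_mul, mul_comm (n : ℝ)]
  field_simp
  ring

lemma integral_exp_mul_floor {β S : ℝ} (hβ : 0 < β) {u : ℕ → ℝ} (hu : ∀ n, 0 ≤ u n)
    (hS : HasSum (fun n => u n * Real.exp (-β) ^ n) S) :
    ∫ x in Set.Ioi (0 : ℝ), Real.exp (-β * x) * u ⌊x⌋₊ = S * ((1 - Real.exp (-β)) / β) := by
  let F : ℕ → ℝ → ℝ := fun n =>
    (Set.Ico (n : ℝ) (n + 1)).indicator fun x => Real.exp (-β * x) * u n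
  have hFint : ∀ n, Integrable (F n) := fun n => by
    refine (integrable_indicator_iff measurableSet_Ico).2 ?_
    exact ((by fun_prop : Continuous fun x => Real.exp (-β * x) * u n).integrableOn_Icc).mono_set
      Set.Ico_subset_Icc_self
  have hFval : ∀ n, ∫ x, F n x = u n * Real.exp (-β) ^ n * ((1 - Real.exp (-β)) / β) := fun n => by
    rw [integral_indicator measurableSet_Ico, integral_mul_const, integral_Ico_exp hβ.ne']
    ring
  have hFnn : ∀ n x, ‖F n x‖ = F n x := fun n x => by
    refine Real.norm_of_nonneg (Set.indicator_nonneg (fun x _ => ?_) x)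
    exact mul_nonneg (Real.exp_pos _).le (hu n)
  have hval : HasSum (fun n => ∫ x, F n x) (S * ((1 - Real.exp (-β)) / β)) := by
    simp_rw [hFval]
    exact hS.mul_right _
  have hF := hasSum_integral_of_summable_integral_norm hFint
    (by simp_rw [hFnn]; exact hval.summable)
  rw [← hval.unique hF |>.symm, ← integral_Ici_eq_integral_Ioi,
    ← integral_indicator measurableSet_Ici]
  refine integral_congr_ae (Eventually.of_forall fun x => ?_)
  simp only
  by_cases hx : 0 ≤ x
  · rw [Set.indicator_of_mem (Set.mem_Ici.2 hx), tsum_eq_single ⌊x⌋₊]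
    · exact (Set.indicator_of_mem (Set.mem_Ico.2 ⟨Nat.floor_le hx, Nat.lt_floor_add_one x⟩)
        (fun x => Real.exp (-β * x) * u ⌊_⌋₊)).symm
    · intro n hn
      refine Set.indicator_of_notMem (fun hmem => hn ?_) _
      exact ((Nat.floor_eq_iff hx).2 hmem).symm
  · rw [Set.indicator_of_notMem (by simpa using hx)]
    symm
    have : ∀ n : ℕ, F n x = 0 := fun n => by
      refine Set.indicator_of_notMem (fun hmem => hx ?_) _
      exact n.cast_nonneg.trans hmem.1
    simp [this]

/-- Both directions matter: existence makes the choice in `scaleW` meaningful, and uniqueness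
computes it. A single `β` determines the constant, because the transform is nonzero there. -/
lemma IsIncrementLaw.isNormalisation_iff (hν : IsIncrementLaw ν m) (hm : IsStepFamily lam m)
    (h : IsSkipFreeMeasure lam) (C : ℝ) : IsNormalisation 1 ν lam C ↔ C = 1 / lam.real {1} := by
  have h1 := h.real_one_pos
  have hint : ∀ β, largestZero lam < β →
      ∫ x in Set.Ioi (0 : ℝ), Real.exp (-β * x) * (C * rawScale 1 ν x) =
        C * lam.real {1} * ((Real.exp (β * 1) - 1) / (β * 1 * laplaceExponent lam β)) := by
    intro β hβ
    have hβ0 : 0 < β := h.largestZero_nonneg.trans_lt hβ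
    have hψ := h.laplaceExponent_ne_zero hβ
    have e := integral_exp_mul_floor hβ0 (fun n => (h.scaleSeq_pos n).le)
      (h.hasSum_scaleSeq (hν.monotone_scaleSeq_ratio hm h) hβ)
    simp_rw [hν.rawScale_eq hm h, mul_left_comm _ C]
    rw [integral_const_mul, e, mul_one, Real.exp_neg]
    have := (Real.exp_pos β).ne'
    field_simp
  constructor
  · intro hC
    obtain ⟨β, hβ⟩ := exists_gt (largestZero lam)
    have hβ0 : 0 < β := h.largestZero_nonneg.trans_lt hβ
    have e := (hint β hβ).symm.trans (hC β hβ)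
    have hne : (Real.exp (β * 1) - 1) / (β * 1 * laplaceExponent lam β) ≠ 0 := by
      refine div_ne_zero ?_ (mul_ne_zero (by simpa using hβ0.ne') (h.laplaceExponent_ne_zero hβ))
      rw [mul_one, sub_ne_zero]
      exact (Real.one_lt_exp_iff.2 hβ0).ne'
    rw [eq_div_iff h1.ne']
    exact (mul_eq_right₀ hne).1 e
  · rintro rfl β hβ
    rw [hint β hβ, one_div_mul_cancel h1.ne', one_mul]

lemma IsIncrementLaw.scaleW_eq (hν : IsIncrementLaw ν m) (hm : IsStepFamily lam m)
    (h : IsSkipFreeMeasure lam) {x : ℝ} (hx : 0 ≤ x) :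
    scaleW 1 ν lam x = scaleSeq lam ⌊x⌋₊ / lam.real {1} := by
  have hex : ∃ C, IsNormalisation 1 ν lam C := ⟨_, (hν.isNormalisation_iff hm h _).2 rfl⟩
  rw [scaleW, if_neg (not_lt.2 hx),
    (hν.isNormalisation_iff hm h _).1 (Classical.epsilon_spec hex), hν.rawScale_eq hm h]
  ring

end Identify

/-! ### The `q`-scale functions and the jump matrix on the integers -/

/-- The `q`-scale function on the non-negative integers. -/
def qScaleSeq (lam : Measure ℝ) (c : ℝ) (k : ℕ) : ℝ :=
  Real.exp (c * (k + 1)) * (scaleSeq (tilt lam c) k / (tilt lam c).real {1})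

lemma qScaleW_eq {Ω : Type*} [MeasurableSpace Ω] {P : Measure Ω} {X : ℝ≥0 → Ω → ℝ}
    {lam : Measure ℝ} (hX : IsSkipFreeLevyChain 1 X P lam) {q : ℝ} (hq : 0 ≤ q) {x : ℝ}
    (hx : 0 ≤ x) : qScaleW 1 (pathLaw X hX.cadlag P) lam q x =
      qScaleSeq lam (invLaplaceExponent lam q) ⌊x⌋₊ := by
  have h := hX.isSkipFreeMeasure
  have hc := (h.invLaplaceExponent_spec hq).1
  have hm := isStepFamily_tiltStep h (isStepFamily_compoundPoissonLaw h) hc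
    (lintegral_exp_compoundPoissonLaw_eq h hc)
  have hν := (hX.toIsCompoundPoisson.isIncrementLaw hX.cadlag).expChange hm.prob
  rw [qScaleW, if_neg (not_lt.2 hx), hν.scaleW_eq hm (h.tilt hc) hx, qScaleSeq, div_one, mul_one,
    add_comm 1 x, Int.floor_add_one, ← Int.natCast_floor_eq_floor hx]
  push_cast
  rfl

lemma qScaleSeq_zero {lam : Measure ℝ} (c : ℝ) :
    qScaleSeq lam c 0 = 1 / lam.real {1} := by
  rw [qScaleSeq, tilt_real_singleton, scaleSeq]
  have := (Real.exp_pos c).ne'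
  simp
  field_simp

/-- The recursion for the tilted measure, multiplied by `e^{c(k+1)}`: this factor absorbs the
weights `e^{c}` and `e^{-cl}` of the atoms, and only the total mass keeps a trace of the tilt. -/
lemma qScaleSeq_succ {lam : Measure ℝ} (h : IsSkipFreeMeasure lam) {c : ℝ} (hc : 0 ≤ c) (k : ℕ) :
    lam.real {1} * qScaleSeq lam c (k + 1) =
      (lam.real Set.univ + laplaceExponent lam c) * qScaleSeq lam c k -
        ∑ l ∈ Finset.Icc 1 k, lam.real {-(l : ℝ)} * qScaleSeq lam c (k - l) := by
  have e := (h.tilt hc).scaleSeq_succ k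
  simp only [tilt_real_singleton, h.tilt_univ hc, mul_one] at e
  have hsum : ∑ l ∈ Finset.Icc 1 k, lam.real {-(l : ℝ)} * qScaleSeq lam c (k - l) =
      Real.exp (c * (k + 1)) / (tilt lam c).real {1} *
        ∑ l ∈ Finset.Icc 1 k, Real.exp (c * -(l : ℝ)) * lam.real {-(l : ℝ)} *
          scaleSeq (tilt lam c) (k - l) := by
    rw [Finset.mul_sum]
    refine Finset.sum_congr rfl fun l hl => ?_
    have hlk : l ≤ k := (Finset.mem_Icc.1 hl).2
    rw [qScaleSeq, Nat.cast_sub hlk, show c * ((k : ℝ) - l + 1) = c * (k + 1) + c * -(l : ℝ) by ring,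
      Real.exp_add]
    ring
  rw [hsum]
  have hk : lam.real {1} * qScaleSeq lam c (k + 1) =
      Real.exp (c * (k + 1)) / (tilt lam c).real {1} *
        (Real.exp c * lam.real {1} * scaleSeq (tilt lam c) (k + 1)) := by
    rw [qScaleSeq, show c * (((k + 1 : ℕ) : ℝ) + 1) = c * (k + 1) + c by push_cast; ring,
      Real.exp_add]
    ring
  rw [hk, e, qScaleSeq]
  ring

/-- The summed recursion. The extra `1` is `lam.real {1}` times the initial value `1 / lam.real
{1}`. -/
lemma qScaleSeq_sum_succ {lam : Measure ℝ} (h : IsSkipFreeMeasure lam) {c : ℝ} (hc : 0 ≤ c)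
    (k : ℕ) :
    lam.real {1} * ∑ j ∈ Finset.range (k + 1), qScaleSeq lam c j +
        ∑ l ∈ Finset.Icc 1 k, lam.real {-(l : ℝ)} * ∑ j ∈ Finset.range (k - l), qScaleSeq lam c j =
      (lam.real Set.univ + laplaceExponent lam c) * ∑ j ∈ Finset.range k, qScaleSeq lam c j + 1 := by
  induction k with
  | zero => simp [qScaleSeq_zero, h.real_one_pos.ne']
  | succ k ih =>
    have h1 : ∑ l ∈ Finset.Icc 1 (k + 1),
          lam.real {-(l : ℝ)} * ∑ j ∈ Finset.range (k + 1 - l), qScaleSeq lam c j =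
        ∑ l ∈ Finset.Icc 1 k, lam.real {-(l : ℝ)} * ∑ j ∈ Finset.range (k - l), qScaleSeq lam c j +
          ∑ l ∈ Finset.Icc 1 k, lam.real {-(l : ℝ)} * qScaleSeq lam c (k - l) := by
      rw [Finset.sum_Icc_succ_top (by omega), Nat.sub_self, Finset.sum_range_zero, mul_zero,
        add_zero, ← Finset.sum_add_distrib]
      refine Finset.sum_congr rfl fun l hl => ?_
      rw [Nat.sub_add_comm (Finset.mem_Icc.1 hl).2, Finset.sum_range_succ, mul_add]
    rw [h1, Finset.sum_range_succ, mul_add, qScaleSeq_succ h hc, Finset.sum_range_succ _ k]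
    rw [Finset.sum_range_succ] at ih
    linarith

/-- The action of the jump matrix on functions vanishing on the negative integers. -/
lemma hasSum_jumpMatrix {lam : Measure ℝ} (h : IsSkipFreeMeasure lam) (k : ℕ) {V : ℤ → ℝ} {S : ℝ}
    (hS : HasSum (fun i : ℕ => lam.real {1 - (i : ℝ)} / lam.real Set.univ * V (k + 1 - i)) S) :
    HasSum (fun l : ℤ => jumpMatrix lam k l * V l) S := by
  have hinj : Function.Injective fun i : ℕ => ((k : ℤ) + 1 - i) := fun a b hab => by
    simpa using hab
  refine (hinj.hasSum_iff fun l hl => ?_).1 ?_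
  · have hlk : (k : ℤ) + 1 < l := by
      by_contra hle
      exact hl ⟨((k : ℤ) + 1 - l).toNat, by simp only; omega⟩
    have h0 : lam {((l - k : ℤ) : ℝ)} = 0 := by
      refine measure_mono_null ?_ h.upper
      rw [Set.singleton_subset_iff, Set.mem_Ioi]
      exact_mod_cast (by omega : (1 : ℤ) < l - k)
    rw [jumpMatrix, measureReal_def, h0]
    simp
  · convert hS using 1
    ext i
    simp only [Function.comp_apply, jumpMatrix]
    congr 4
    push_cast; ring

lemma sum_range_jump {lam : Measure ℝ} (h : IsSkipFreeMeasure lam) (k : ℕ) (V : ℤ → ℝ) :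
    ∑ i ∈ Finset.range (k + 2), lam.real {1 - (i : ℝ)} / lam.real Set.univ * V (k + 1 - i) =
      lam.real {1} / lam.real Set.univ * V (k + 1) +
        ∑ l ∈ Finset.Icc 1 k, lam.real {-(l : ℝ)} / lam.real Set.univ * V (k - l) := by
  have hz : lam.real {(0 : ℝ)} = 0 := by rw [measureReal_def, h.zero, ENNReal.toReal_zero]
  have h2 : ∑ l ∈ Finset.Icc 1 k, lam.real {-(l : ℝ)} / lam.real Set.univ * V (k - l) =
      ∑ l ∈ Finset.range k,
        lam.real {-((l + 1 : ℕ) : ℝ)} / lam.real Set.univ * V (k - (l + 1 : ℕ)) := by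
    rw [Finset.range_eq_Ico, Finset.sum_Ico_add'
      (fun l : ℕ => lam.real {-((l : ℕ) : ℝ)} / lam.real Set.univ * V (k - (l : ℤ))) 0 k 1]
    rfl
  rw [Finset.sum_range_succ', Finset.sum_range_succ', h2]
  have h3 : ∀ i : ℕ, lam.real {1 - ((i + 1 + 1 : ℕ) : ℝ)} / lam.real Set.univ *
      V (k + 1 - (i + 1 + 1 : ℕ)) =
      lam.real {-((i + 1 : ℕ) : ℝ)} / lam.real Set.univ * V (k - (i + 1 : ℕ)) := by
    intro i
    rw [show (1 : ℝ) - ((i + 1 + 1 : ℕ) : ℝ) = -((i + 1 : ℕ) : ℝ) by push_cast; ring,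
      show (k : ℤ) + 1 - (i + 1 + 1 : ℕ) = k - (i + 1 : ℕ) by push_cast; ring]
  simp_rw [h3]
  simp [hz]
  ring

lemma hasSum_jumpMatrix_of_neg {lam : Measure ℝ} (h : IsSkipFreeMeasure lam) (k : ℕ) {V : ℤ → ℝ}
    (hV : ∀ n < 0, V n = 0) :
    HasSum (fun l : ℤ => jumpMatrix lam k l * V l)
      (lam.real {1} / lam.real Set.univ * V (k + 1) +
        ∑ l ∈ Finset.Icc 1 k, lam.real {-(l : ℝ)} / lam.real Set.univ * V (k - l)) := by
  refine hasSum_jumpMatrix h k ?_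
  rw [← sum_range_jump h]
  refine hasSum_sum_of_ne_finset_zero fun i hi => ?_
  rw [Finset.mem_range, not_lt] at hi
  rw [hV _ (by omega), mul_zero]

lemma hasSum_jumpMatrix_one {lam : Measure ℝ} (h : IsSkipFreeMeasure lam) (k : ℕ) :
    HasSum (fun l : ℤ => jumpMatrix lam k l) 1 := by
  have := h.finite
  have h1 := hasSum_jumpMatrix h k (V := fun _ => 1) (S := 1) (by
    have h2 := (h.hasSum_integral (integrable_const (1 : ℝ))).div_const (lam.real Set.univ)
    simpa [h.real_univ_pos.ne'] using h2)
  simpa using h1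

lemma qScaleZ_eq {Ω : Type*} [MeasurableSpace Ω] {P : Measure Ω} {X : ℝ≥0 → Ω → ℝ}
    {lam : Measure ℝ} (hX : IsSkipFreeLevyChain 1 X P lam) {q : ℝ} (hq : 0 ≤ q) (k : ℕ) :
    qScaleZ 1 (pathLaw X hX.cadlag P) lam q k =
      1 + q * ∑ j ∈ Finset.range k, qScaleSeq lam (invLaplaceExponent lam q) j := by
  rw [qScaleZ, if_neg (by simp), div_one, Int.floor_natCast, mul_one, Int.cast_natCast]
  set g := qScaleW 1 (pathLaw X hX.cadlag P) lam q with hg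
  set u := qScaleSeq lam (invLaplaceExponent lam q) with hu
  have hae : ∀ j : ℕ, ∀ᵐ x ∂(volume : Measure ℝ), x ∈ Set.uIoc (j : ℝ) ((j + 1 : ℕ) : ℝ) →
      g x = u j := by
    intro j
    -- The right endpoint is discarded, since the floor jumps there.
    have h1 : ∀ᵐ x ∂(volume : Measure ℝ), x ≠ ((j + 1 : ℕ) : ℝ) := by
      simp [ae_iff]
    filter_upwards [h1] with x hx hmem
    rw [Set.uIoc_of_le (by simp)] at hmem
    have hx0 : 0 ≤ x := j.cast_nonneg.trans hmem.1.le
    rw [hg, qScaleW_eq hX hq hx0, (Nat.floor_eq_iff hx0).2 ⟨hmem.1.le, ?_⟩]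
    have := lt_of_le_of_ne hmem.2 hx
    exact_mod_cast this
  have hint : ∀ j : ℕ, IntervalIntegrable g volume (j : ℝ) ((j + 1 : ℕ) : ℝ) := by
    intro j
    refine (intervalIntegrable_const (c := u j)).congr_ae ?_
    rw [EventuallyEq, ae_restrict_iff' measurableSet_uIoc]
    exact (hae j).mono fun x hx hmem => (hx hmem).symm
  have hval : ∀ j : ℕ, ∫ x in (j : ℝ)..((j + 1 : ℕ) : ℝ), g x = u j := by
    intro j
    rw [intervalIntegral.integral_congr_ae (hae j), intervalIntegral.integral_const]
    simp
  have := intervalIntegral.sum_integral_adjacent_intervals (f := g) (μ := volume)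
    (a := fun j : ℕ => (j : ℝ)) (n := k) fun j _ => hint j
  rw [Nat.cast_zero] at this
  rw [← this, Finset.sum_congr rfl fun j _ => hval j]

end SkipFree

end

/-! ### The eigenvector equations, recursions and boundary values -/

theorem mainTheorem4 {Ω : Type*} [MeasurableSpace Ω] (P : Measure Ω) (X : ℝ≥0 → Ω → ℝ)
    (lam : Measure ℝ) (hX : SkipFree.IsSkipFreeLevyChain 1 X P lam) (q : ℝ) (hq : 0 ≤ q)
    (W Z : ℤ → ℝ)
    (hW : ∀ k : ℤ, W k = SkipFree.qScaleW 1 (SkipFree.pathLaw X hX.cadlag P) lam q (k : ℝ))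
    (hZ : ∀ k : ℤ, Z k = SkipFree.qScaleZ 1 (SkipFree.pathLaw X hX.cadlag P) lam q (k : ℝ))
    (γ p : ℝ) (hγ : γ = lam.real Set.univ) (hp : p = lam.real {1} / γ)
    (qs : ℕ → ℝ) (hqs : ∀ l : ℕ, qs l = lam.real {-(l : ℝ)} / γ) :
    -- the eigenvector equations `(P W)(k) = (1 + q / γ) W(k)`, `(P Z)(k) = (1 + q / γ) Z(k)`
    (∀ k : ℤ, 0 ≤ k →
      HasSum (fun l : ℤ => SkipFree.jumpMatrix lam k l * W l) ((1 + q / γ) * W k) ∧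
      HasSum (fun l : ℤ => SkipFree.jumpMatrix lam k l * Z l) ((1 + q / γ) * Z k)) ∧
    -- the recursions
    (∀ k : ℕ, p * W (k + 1) =
      (1 + q / γ) * W k - ∑ l ∈ Finset.Icc 1 k, qs l * W ((k : ℤ) - l)) ∧
    (∀ k : ℕ, p * Z (k + 1) + (1 - p - ∑ l ∈ Finset.Ico 1 k, qs l) =
      (1 + q / γ) * Z k - ∑ l ∈ Finset.Ico 1 k, qs l * Z ((k : ℤ) - l)) ∧
    -- the boundary data
    (∀ k : ℤ, k < 0 → W k = 0) ∧ W 0 = 1 / lam.real {1} ∧ (∀ k : ℤ, k ≤ 0 → Z k = 1) := by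

  have h := hX.isSkipFreeMeasure
  obtain ⟨hc, hψ⟩ := h.invLaplaceExponent_spec hq
  set c := SkipFree.invLaplaceExponent lam q with hcdef
  have hγ0 : γ ≠ 0 := by rw [hγ]; exact h.real_univ_pos.ne'
  have hWnat : ∀ k : ℕ, W k = SkipFree.qScaleSeq lam c k := fun k => by
    rw [hW, Int.cast_natCast, SkipFree.qScaleW_eq hX hq k.cast_nonneg, Nat.floor_natCast]
  have hWneg : ∀ k : ℤ, k < 0 → W k = 0 := fun k hk => by
    rw [hW, SkipFree.qScaleW, if_pos (by exact_mod_cast hk)]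
  have hZnat : ∀ k : ℕ, Z k = 1 + q * ∑ j ∈ Finset.range k, SkipFree.qScaleSeq lam c j :=
    fun k => by rw [hZ, Int.cast_natCast, SkipFree.qScaleZ_eq hX hq]
  have hZneg : ∀ k : ℤ, k ≤ 0 → Z k = 1 := fun k hk => by
    rcases hk.lt_or_eq with hk | rfl
    · rw [hZ, SkipFree.qScaleZ, if_pos (by exact_mod_cast hk)]
    · simpa using hZnat 0
  have hWrec : ∀ k : ℕ, p * W (k + 1) =
      (1 + q / γ) * W k - ∑ l ∈ Finset.Icc 1 k, qs l * W ((k : ℤ) - l) := by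
    intro k
    have e := SkipFree.qScaleSeq_succ h hc k
    rw [hψ, ← hγ] at e
    have hsum : ∑ l ∈ Finset.Icc 1 k, qs l * W ((k : ℤ) - l) =
        (∑ l ∈ Finset.Icc 1 k, lam.real {-(l : ℝ)} * SkipFree.qScaleSeq lam c (k - l)) / γ := by
      rw [Finset.sum_div]
      refine Finset.sum_congr rfl fun l hl => ?_
      rw [hqs, ← Nat.cast_sub (Finset.mem_Icc.1 hl).2, hWnat]
      ring
    have hW1 : W ((k : ℤ) + 1) = SkipFree.qScaleSeq lam c (k + 1) := by exact_mod_cast hWnat (k + 1)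
    rw [hsum, hW1, hWnat, hp]
    field_simp
    linarith
  -- The function `Z - 1` vanishes on the integers up to `0`, so it satisfies a finite recursion
  -- like that of `W`, with inhomogeneity `q / γ`.
  have hZaux : ∀ k : ℕ, p * (Z (k + 1) - 1) + ∑ l ∈ Finset.Icc 1 k, qs l * (Z ((k : ℤ) - l) - 1) =
      (1 + q / γ) * (Z k - 1) + q / γ := by
    intro k
    have e := SkipFree.qScaleSeq_sum_succ h hc k
    rw [hψ, ← hγ] at e
    have hsum : ∑ l ∈ Finset.Icc 1 k, qs l * (Z ((k : ℤ) - l) - 1) =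
        q * (∑ l ∈ Finset.Icc 1 k, lam.real {-(l : ℝ)} *
          ∑ j ∈ Finset.range (k - l), SkipFree.qScaleSeq lam c j) / γ := by
      rw [Finset.mul_sum, Finset.sum_div]
      refine Finset.sum_congr rfl fun l hl => ?_
      rw [hqs, ← Nat.cast_sub (Finset.mem_Icc.1 hl).2, hZnat]
      ring
    have hZ1 : Z ((k : ℤ) + 1) =
        1 + q * ∑ j ∈ Finset.range (k + 1), SkipFree.qScaleSeq lam c j := by
      exact_mod_cast hZnat (k + 1)
    rw [hsum, hZ1, hZnat, hp]
    field_simp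
    linear_combination q * e
  -- The term `l = k` involves `Z 0 - 1 = 0`, which is why the sum for `Z` stops at `k - 1`.
  have hIco : ∀ k : ℕ, ∑ l ∈ Finset.Icc 1 k, qs l * (Z ((k : ℤ) - l) - 1) =
      ∑ l ∈ Finset.Ico 1 k, qs l * (Z ((k : ℤ) - l) - 1) := by
    intro k
    rcases Nat.eq_zero_or_pos k with rfl | hk
    · simp
    · rw [show Finset.Icc 1 k = insert k (Finset.Ico 1 k) by ext l; simp; omega, Finset.sum_insert (by simp), hZneg _ (by simp)]
      simp
  refine ⟨fun k hk => ?_, hWrec, fun k => ?_, hWneg, ?_, hZneg⟩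
  · obtain ⟨k, rfl⟩ := Int.eq_ofNat_of_zero_le hk
    constructor
    · convert SkipFree.hasSum_jumpMatrix_of_neg h k hWneg using 1
      simp only [hp, hqs, hγ] at hWrec
      rw [hγ, hWrec]
      ring
    · have e1 := SkipFree.hasSum_jumpMatrix_of_neg h k (V := fun n => Z n - 1)
        -- Adding the row sum `1` then turns `Z - 1` into `Z`, since `(1 + q/γ)(Z - 1) + q/γ + 1 =
        -- (1 + q/γ) Z`.
        fun n hn => by rw [hZneg n hn.le, sub_self]
      have e2 := e1.add (SkipFree.hasSum_jumpMatrix_one h k)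
      simp only [hp, hqs, hγ] at hZaux
      rw [hZaux] at e2
      convert e2 using 1
      · ext l; ring
      · rw [hγ]; ring
  · have e := hZaux k
    rw [hIco] at e
    simp only [mul_sub, mul_one, Finset.sum_sub_distrib] at e
    linarith
  · simpa [SkipFree.qScaleSeq_zero] using hWnat 0
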